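/- For complex $\alpha,\alpha',\beta,\beta',\gamma$ with $\Re\gamma>0$ and $x>0$, let the right-sided Marichev--Saigo--Maeda operator be $$\left(I_{0,-}^{\alpha,\alpha',\beta,\beta',\gamma}f\right)(x)=\frac{x^{-\alpha'}}{\Gamma(\gamma)}\int_x^\infty (t-x)^{\gamma-1}t^{-\alpha}F_3\!\left(\alpha,\alpha',\beta,\beta';\gamma;1-\frac{x}{t},1-\frac{t}{x}\right)f(t)\,dt,$$ where $F_3(a,a',b,b';c;X,Y)=\sum_{m,n\ge0}\frac{(a)_m(a')_n(b)_m(b')_n}{(c)_{m+n}\,m!\,n!}X^mY^n$ for $|X|,|Y|<1$, continued analytically in $Y$ to the union of the unit disc and the left half plane. Let ${}_pF_q[a_1,\dots,a_p;b_1,\dots,b_q\,|\,z]=\sum_{k\ge0}\frac{(a_1)_k\cdots(a_p)_k}{(b_1)_k\cdots(b_q)_k\,k!}z^k$. Let $\alpha,\alpha',\beta,\beta',\gamma,\rho,c\in\mathbb C$ and $x>0$ satisfy $\Re\gamma>0$ and $$\Re\rho<\min\{\Re(-\beta),\ \Re(\alpha+\alpha'-\gamma),\ \Re(\alpha+\beta'-\gamma)\},$$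 and suppose that none of $-\rho$, $\alpha+\alpha'+\beta'-\gamma-\rho$, $\alpha-\beta-\rho$ is zero or a negative integer (so that no bottom parameter below is zero or a negative integer). Write $$C=\frac{\Gamma(\alpha+\alpha'-\gamma-\rho)\,\Gamma(\alpha+\beta'-\gamma-\rho)\,\Gamma(-\beta-\rho)}{\Gamma(-\rho)\,\Gamma(\alpha+\alpha'+\beta'-\gamma-\rho)\,\Gamma(\alpha-\beta-\rho)},$$ $$\Phi(z)={}_6F_7\!\left[\begin{array}{c}\frac{\alpha+\alpha'-\gamma-\rho}{2},\frac{\alpha+\alpha'-\gamma-\rho+1}{2},\frac{\alpha+\beta'-\gamma-\rho}{2},\frac{\alpha+\beta'-\gamma-\rho+1}{2},\frac{-\beta-\rho}{2},\frac{-\beta-\rho+1}{2};\\ \frac12,\frac{-\rho}{2},\frac{-\rho+1}{2},\frac{\alpha+\alpha'+\beta'-\gamma-\rho}{2},\frac{\alpha+\alpha'+\beta'-\gamma-\rho+1}{2},\frac{\alpha-\beta-\rho}{2},\frac{\alpha-\beta-\rho+1}{2}\end{array}\Big|\,z\right].$$ Then the integrals defining the left-hand sides converge absolutely and $$\left(I_{0,-}^{\alpha,\alpha',\beta,\beta',\gamma}\,t^{\rho}\cos\frac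 ct\right)(x)=C\,x^{\rho-\alpha-\alpha'+\gamma}\,\Phi\!\left(-\frac{c^2}{4x^2}\right),$$ $$\left(I_{0,-}^{\alpha,\alpha',\beta,\beta',\gamma}\,t^{\rho}\cosh\frac ct\right)(x)=C\,x^{\rho-\alpha-\alpha'+\gamma}\,\Phi\!\left(\frac{c^2}{4x^2}\right).$$ -/

import Mathlib

open MeasureTheory Set

/-- The Pochhammer symbol `(a)_k = a (a + 1) ⋯ (a + k - 1)`. -/
noncomputable def poch (a : ℂ) (k : ℕ) : ℂ := (ascPochhammer ℂ k).eval a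

/-- The generalized hypergeometric series `ₚF_q(a₁, …, aₚ; b₁, …, b_q; z)`
(no entry of `bs` is to be zero or a negative integer). -/
noncomputable def genHypergeom (as bs : List ℂ) (z : ℂ) : ℂ :=
  ∑' k : ℕ, (as.map fun a => poch a k).prod /
    ((bs.map fun b => poch b k).prod * (k.factorial : ℂ)) * z ^ k

/-- The double power series of the third Appell (Horn) function; it converges absolutely
for `‖X‖ < 1`, `‖Y‖ < 1`. -/
noncomputable def appellF3Series (a a' b b' c X Y : ℂ) : ℂ :=
  ∑' p : ℕ × ℕ, poch a p.1 * poch a' p.2 * poch b p.1 * poch b' p.2 /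
    (poch c (p.1 + p.2) * (p.1.factorial : ℂ) * (p.2.factorial : ℂ)) * X ^ p.1 * Y ^ p.2

/-- The union of the open unit disc and the open left half plane. -/
def appellF3Domain : Set ℂ := {Y | ‖Y‖ < 1 ∨ Y.re < 0}

/-- `G` is the analytic continuation of `Y ↦ F₃(a, a', b, b'; c; X, Y)` from the unit disc to
its union with the left half plane. -/
def IsAppellF3Continuation (a a' b b' c X : ℂ) (G : ℂ → ℂ) : Prop :=
  DifferentiableOn ℂ G appellF3Domain ∧
    ∀ Y : ℂ, ‖Y‖ < 1 → G Y = appellF3Series a a' b b' c X Y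

/-- The continuation is unique. -/
theorem IsAppellF3Continuation.eqOn {a a' b b' c X : ℂ} {G H : ℂ → ℂ}
    (hG : IsAppellF3Continuation a a' b b' c X G)
    (hH : IsAppellF3Continuation a a' b b' c X H) : EqOn G H appellF3Domain := by
  have hdom : appellF3Domain = Metric.ball (0 : ℂ) 1 ∪ {Y : ℂ | Y.re < 0} := by
    ext Y; simp [appellF3Domain]
  have hopen : IsOpen appellF3Domain := by
    rw [hdom]
    exact Metric.isOpen_ball.union (isOpen_lt Complex.continuous_re continuous_const)
  have hconn : IsPreconnected appellF3Domain := by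
    rw [hdom]
    refine IsPreconnected.union (-(1 / 2) : ℂ) ?_ ?_
      (convex_ball (0 : ℂ) 1).isPreconnected (convex_halfSpace_re_lt 0).isPreconnected
    · simp; norm_num
    · simp
  refine (hG.1.analyticOnNhd hopen).eqOn_of_preconnected_of_eventuallyEq
    (hH.1.analyticOnNhd hopen) hconn (z₀ := 0) (by simp [appellF3Domain]) ?_
  filter_upwards [Metric.ball_mem_nhds (0 : ℂ) one_pos] with Y hY
  have hY' : ‖Y‖ < 1 := by simpa using hY
  rw [hG.2 Y hY', hH.2 Y hY']

open Classical in
/-- The third Appell (Horn) function `F₃(a, a', b, b'; c; X, Y)` for `‖X‖ < 1` and `Y` in the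
union of the unit disc and the left half plane: the analytic continuation of the double series. -/
noncomputable def appellF3 (a a' b b' c X Y : ℂ) : ℂ :=
  if h : ∃ G : ℂ → ℂ, IsAppellF3Continuation a a' b b' c X G then h.choose Y else 0

/-- The integrand of the right-sided Marichev-Saigo-Maeda operator at the point `x`. -/
noncomputable def msmRightIntegrand (α α' β β' γ : ℂ) (f : ℝ → ℂ) (x t : ℝ) : ℂ :=
  ((t - x : ℝ) : ℂ) ^ (γ - 1) * (t : ℂ) ^ (-α) *
    appellF3 α α' β β' γ (1 - (x : ℂ) / (t : ℂ)) (1 - (t : ℂ) / (x : ℂ)) * f t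

/-- The right-sided Marichev-Saigo-Maeda fractional integral. -/
noncomputable def msmRight (α α' β β' γ : ℂ) (f : ℝ → ℂ) (x : ℝ) : ℂ :=
  (x : ℂ) ^ (-α') / Complex.Gamma γ * ∫ t in Ioi x, msmRightIntegrand α α' β β' γ f x t

/-- The Gamma ratio in the image formulas. -/
noncomputable def msmGammaRatio (α α' β β' γ ρ : ℂ) : ℂ :=
  (Complex.Gamma (α + α' - γ - ρ) * Complex.Gamma (α + β' - γ - ρ) * Complex.Gamma (-β - ρ)) /
    (Complex.Gamma (-ρ) * Complex.Gamma (α + α' + β' - γ - ρ) * Complex.Gamma (α - β - ρ))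

/-- The `₆F₇` series in the image formulas. -/
noncomputable def msmSixFSeven (α α' β β' γ ρ z : ℂ) : ℂ :=
  genHypergeom
    [(α + α' - γ - ρ) / 2, (α + α' - γ - ρ + 1) / 2,
      (α + β' - γ - ρ) / 2, (α + β' - γ - ρ + 1) / 2,
      (-β - ρ) / 2, (-β - ρ + 1) / 2]
    [1 / 2, -ρ / 2, (-ρ + 1) / 2,
      (α + α' + β' - γ - ρ) / 2, (α + α' + β' - γ - ρ + 1) / 2,
      (α - β - ρ) / 2, (α - β - ρ + 1) / 2] z

/-!
The proof computes the Mellin transform of the kernel of the operator and then sums over the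
Taylor series of `cosh`; the cosine is `cosh` with `c` replaced by `c * I`.

*The kernel.* At `X = 1 - x / t`, `Y = 1 - t / x` one has `Y / (Y - 1) = X`. Pfaff's transformation
in the second summation index continues `F₃` in `Y` to the half plane `re Y < 1 / 2`
(`appellF3_eq_pfaffSeries`), and at these points it gives, with `y = x / t`,
`F₃ = y ^ α' * Φ (1 - y)` for a power series `Φ`, the `kernelSeries`. The substitution `t = x / y`
turns the integral of `t ^ ρ g(t)` into
`∫₀¹ y ^ (z - 1) y ^ (α + α' - γ) (1 - y) ^ (γ - 1) Φ (1 - y) g(x / y) dy` with `z = -ρ`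
(`msmRight_substitution`).

*Its Mellin transform.* For `g = 1` integrate the double series term by term and apply Gauss's
theorem (`hasSum_gauss`) in the second and then in the first index. The result is
`Γ(γ) ∏ Γ(z + sᵢ) / ∏ Γ(z + tᵢ)` with `s = (α + α' - γ, α + β' - γ, -β)` and
`t = (0, α + α' + β' - γ, α - β)`, which is the Gamma ratio of the statement. The interchange is
legitimate when `re z` is large, or when `re (t₂ - s₂) = re α' > 0`, in which case it is so for all
`z` with `re (z + sᵢ) > 0` (`mellin_mellinKernel_of_absolute`); when `re α' ≤ 0` the double series
of integrals may fail to converge absolutely although the integral itself does.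

*Removing the restriction.* The transform is symmetric in the `sᵢ` and in the `tᵢ`, and a kernel is
determined almost everywhere by its transform at the integers beyond some point, these being moments
of an integrable function on `(0, 1)` (`mellinKernel_ae_eq`). So the indices may be permuted. Since
`∑ (tᵢ - sᵢ) = γ` has positive real part, `re tᵢ > re sᵢ` for some `i`, and permuting `i` to `2`
leads back to the favourable case (`mellin_mellinKernel`).

*Summation.* On `(0, 1)` the integrand with `g(t) = cosh (c / t)` is dominated by a constant times
the one with `g = 1`, which gives absolute convergence and allows summing over the series of `cosh`.
Each term is the Mellin transform at `-ρ + 2k`, and the duplication `(a)_{2k} = 4^k (a/2)_k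
((a+1)/2)_k` produces the `₆F₇` (`msmGammaRatio_sub_two_mul`).
-/

/-! ### Pochhammer symbols and their growth -/

@[simp] lemma poch_zero (a : ℂ) : poch a 0 = 1 := by simp [poch]

lemma poch_succ (a : ℂ) (k : ℕ) : poch a (k + 1) = poch a k * (a + k) := by
  simp [poch, ascPochhammer_succ_eval]

lemma poch_add (a : ℂ) (m n : ℕ) : poch a (m + n) = poch a m * poch (a + m) n := by
  induction n with
  | zero => simp
  | succ n ih => rw [← add_assoc, poch_succ, poch_succ, ih]; push_cast; ring

lemma poch_succ_left (a : ℂ) (k : ℕ) : poch a (k + 1) = a * poch (a + 1) k := by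
  rw [add_comm k 1, poch_add, poch_succ]; simp

lemma poch_ne_zero {a : ℂ} (h : ∀ k : ℕ, a ≠ -(k : ℂ)) (n : ℕ) : poch a n ≠ 0 := by
  induction n with
  | zero => simp
  | succ n ih =>
    rw [poch_succ]
    exact mul_ne_zero ih fun h0 => h n (eq_neg_of_add_eq_zero_left h0)

lemma ne_neg_natCast_of_re_pos {a : ℂ} (h : 0 < a.re) (k : ℕ) : a ≠ -(k : ℂ) := by
  rintro rfl
  simp at h
  exact absurd h (not_lt.mpr (Nat.cast_nonneg k))

/-- The reciprocal form of `Γ (s + n) = (s)_n Γ s`; with the convention `1 / 0 = 0` it holds at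
the poles as well. -/
lemma inv_Gamma_eq_poch_mul (s : ℂ) (n : ℕ) :
    (Complex.Gamma s)⁻¹ = poch s n * (Complex.Gamma (s + n))⁻¹ := by
  induction n with
  | zero => simp
  | succ n ih =>
    rw [ih, Complex.one_div_Gamma_eq_self_mul_one_div_Gamma_add_one (s + n), poch_succ]
    push_cast
    rw [add_assoc s]; ring

lemma Gamma_add_natCast {s : ℂ} (h : ∀ k : ℕ, s ≠ -(k : ℂ)) (n : ℕ) :
    Complex.Gamma (s + n) = poch s n * Complex.Gamma s := by
  have h1 := inv_Gamma_eq_poch_mul s n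
  have h2 := poch_ne_zero h n
  have h3 := Complex.Gamma_ne_zero h
  have h4 : Complex.Gamma (s + n) ≠ 0 := by
    intro h0; rw [h0] at h1; simp at h1; exact h3 h1
  field_simp at h1
  rw [h1, mul_comm]

lemma add_two_div_rpow_eq_exp (x : ℝ) (j : ℕ) :
    (((j : ℝ) + 2) / (j + 1)) ^ x = Real.exp (x * Real.log (1 + 1 / ((j : ℝ) + 1))) := by
  have : ((j : ℝ) + 2) / (j + 1) = 1 + 1 / ((j : ℝ) + 1) := by field_simp; ring
  rw [this, Real.rpow_def_of_pos (by positivity), mul_comm]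

lemma abs_log_one_add_sub_le {h : ℝ} (h0 : 0 ≤ h) : |Real.log (1 + h) - h| ≤ h ^ 2 := by
  have h1 := Real.log_le_sub_one_of_pos (show 0 < 1 + h by linarith)
  have h2 := Real.one_sub_inv_le_log_of_pos (show 0 < 1 + h by linarith)
  have h3 : h - h ^ 2 ≤ 1 - (1 + h)⁻¹ := by
    have : 1 - (1 + h)⁻¹ = h / (1 + h) := by field_simp; ring
    rw [this, le_div_iff₀ (by linarith)]
    nlinarith [pow_nonneg h0 3]
  rw [abs_le]; constructor <;> nlinarith

lemma norm_one_add_le_exp (w : ℂ) : ‖1 + w‖ ≤ Real.exp (w.re + ‖w‖ ^ 2 / 2) := by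
  have h1 : ‖1 + w‖ ^ 2 = 1 + 2 * w.re + ‖w‖ ^ 2 := by
    rw [← Complex.normSq_eq_norm_sq, ← Complex.normSq_eq_norm_sq, Complex.normSq_apply,
      Complex.normSq_apply]; simp; ring
  have h2 : ‖1 + w‖ ^ 2 ≤ Real.exp (w.re + ‖w‖ ^ 2 / 2) ^ 2 := by
    rw [← Real.exp_nat_mul, h1]
    have := Real.add_one_le_exp (2 * w.re + ‖w‖ ^ 2)
    calc _ ≤ Real.exp (2 * w.re + ‖w‖ ^ 2) := by linarith
      _ = _ := by congr 1; push_cast; ring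
  exact le_of_sq_le_sq h2 (Real.exp_pos _).le

/-- The factors of `(z)_n` compared with a product that telescopes to `n! (n + 1) ^ (re z - 1)`; the
correction `exp (K / (j + 1) ^ 2)` has a convergent product. -/
lemma exists_norm_add_natCast_le (z : ℂ) : ∃ K : ℝ, ∀ j : ℕ,
    ‖z + j‖ ≤ (j + 1) * (((j : ℝ) + 2) / (j + 1)) ^ (z.re - 1) *
      Real.exp (K * (1 / ((j : ℝ) + 1) ^ 2)) := by
  refine ⟨‖z - 1‖ ^ 2 / 2 + |z.re - 1|, fun j => ?_⟩
  have hj : (0 : ℝ) < j + 1 := by positivity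
  have hjc : (j : ℂ) + 1 ≠ 0 := by exact_mod_cast hj.ne'
  set h : ℝ := 1 / ((j : ℝ) + 1) with hh
  have h0 : 0 ≤ h := by positivity
  have e1 : z + j = ((j : ℝ) + 1 : ℝ) * (1 + (h : ℂ) * (z - 1)) := by
    rw [hh]; push_cast; field_simp; ring
  rw [e1, norm_mul, add_two_div_rpow_eq_exp, mul_assoc, ← Real.exp_add,
    Complex.norm_of_nonneg hj.le]
  refine mul_le_mul_of_nonneg_left ((norm_one_add_le_exp _).trans (Real.exp_le_exp.mpr ?_)) hj.le
  have e2 := abs_log_one_add_sub_le h0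
  have e3 : ‖(h : ℂ) * (z - 1)‖ = h * ‖z - 1‖ := by
    rw [norm_mul, Complex.norm_of_nonneg h0]
  have e4 : ((h : ℂ) * (z - 1)).re = h * (z.re - 1) := by simp
  have e5 : (1 : ℝ) / ((j : ℝ) + 1) ^ 2 = h ^ 2 := by rw [hh]; field_simp
  rw [e3, e4, e5, ← hh]
  have e6 : |(z.re - 1) * (Real.log (1 + h) - h)| ≤ |z.re - 1| * h ^ 2 := by
    rw [abs_mul]; exact mul_le_mul_of_nonneg_left e2 (abs_nonneg _)
  have := (abs_le.mp e6).1
  nlinarith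

lemma exists_le_norm_add_natCast {z : ℂ} (hz : 0 < z.re) : ∃ K : ℝ, ∀ j : ℕ,
    (j + 1) * (((j : ℝ) + 2) / (j + 1)) ^ (z.re - 1) * Real.exp (-(K * (1 / ((j : ℝ) + 1) ^ 2)))
      ≤ ‖z + j‖ := by
  set x := z.re
  refine ⟨(x - 1) ^ 2 / min x 1 + |x - 1|, fun j => ?_⟩
  have hj : (0 : ℝ) < j + 1 := by positivity
  set h : ℝ := 1 / ((j : ℝ) + 1) with hh
  have h0 : 0 ≤ h := by positivity
  have e0 : x + j ≤ ‖z + j‖ := by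
    have := Complex.re_le_norm (z + j)
    simpa using this
  refine le_trans ?_ e0
  have hm : 0 < min x 1 := lt_min hz one_pos
  have e1 : x + j = (j + 1) * (1 + (x - 1) * h) := by rw [hh]; field_simp; ring
  have hmin : min x 1 ≤ 1 + (x - 1) * h := by
    have : 1 + (x - 1) * h = (x + j) / (j + 1) := by rw [hh]; field_simp; ring
    rw [this, le_div_iff₀ hj]
    have h1 := min_le_left x 1
    have h2 := min_le_right x 1
    nlinarith [(Nat.cast_nonneg j : (0 : ℝ) ≤ j)]
  have hp : 0 < 1 + (x - 1) * h := hm.trans_le hmin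
  rw [e1, add_two_div_rpow_eq_exp, mul_assoc, ← Real.exp_add]
  refine mul_le_mul_of_nonneg_left ?_ hj.le
  rw [← Real.le_log_iff_exp_le hp]
  have e2 := abs_log_one_add_sub_le h0
  have e3 := Real.one_sub_inv_le_log_of_pos hp
  have e4 : (x - 1) * h - (x - 1) ^ 2 / min x 1 * h ^ 2 ≤ 1 - (1 + (x - 1) * h)⁻¹ := by
    have : 1 - (1 + (x - 1) * h)⁻¹ = (x - 1) * h - ((x - 1) * h) ^ 2 / (1 + (x - 1) * h) := by
      field_simp; ring
    rw [this]
    have : ((x - 1) * h) ^ 2 / (1 + (x - 1) * h) ≤ ((x - 1) * h) ^ 2 / min x 1 := by gcongr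
    have e : (x - 1) ^ 2 / min x 1 * h ^ 2 = ((x - 1) * h) ^ 2 / min x 1 := by ring
    rw [e]; linarith
  have e5 : (1 : ℝ) / ((j : ℝ) + 1) ^ 2 = h ^ 2 := by rw [hh]; field_simp
  rw [e5, ← hh]
  have e6 : |(x - 1) * (Real.log (1 + h) - h)| ≤ |x - 1| * h ^ 2 := by
    rw [abs_mul]; exact mul_le_mul_of_nonneg_left e2 (abs_nonneg _)
  have := (abs_le.mp e6).2
  nlinarith

lemma summable_one_div_add_one_sq : Summable fun j : ℕ => 1 / ((j : ℝ) + 1) ^ 2 := by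
  have := (summable_nat_add_iff 1).mpr (Real.summable_one_div_nat_pow.mpr one_lt_two)
  simpa using this

lemma factorial_ratio_succ (m n : ℕ) (x : ℝ) :
    ((m + (n + 1)).factorial : ℝ) / m.factorial *
        (((m + (n + 1) : ℕ) + 1 : ℝ) / (m + 1)) ^ x =
      ((m + n).factorial / m.factorial * (((m + n : ℕ) + 1 : ℝ) / (m + 1)) ^ x) *
        (((m + n : ℕ) + 1) * ((((m + n : ℕ) : ℝ) + 2) / ((m + n : ℕ) + 1)) ^ x) := by
  rw [← add_assoc, Nat.factorial_succ]
  have : (((m + n + 1 : ℕ) : ℝ) + 1) / (m + 1) =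
      (((m + n : ℕ) : ℝ) + 1) / (m + 1) * ((((m + n : ℕ) : ℝ) + 2) / ((m + n : ℕ) + 1)) := by
    push_cast; field_simp; ring
  rw [this, Real.mul_rpow (by positivity) (by positivity)]
  push_cast; ring

/-- Growth of `(z + m)_n = Γ (z + m + n) / Γ (z + m)`, uniformly in both indices and without any
restriction on `z`. -/
lemma exists_norm_poch_add_le (z : ℂ) : ∃ C : ℝ, 0 < C ∧ ∀ m n : ℕ,
    ‖poch (z + m) n‖ ≤ C * ((m + n).factorial / m.factorial *
      (((m + n : ℕ) + 1 : ℝ) / (m + 1)) ^ (z.re - 1)) := by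
  obtain ⟨K, hK⟩ := exists_norm_add_natCast_le z
  have key : ∀ m n : ℕ, ‖poch (z + m) n‖ ≤ (m + n).factorial / m.factorial *
      (((m + n : ℕ) + 1 : ℝ) / (m + 1)) ^ (z.re - 1) *
        Real.exp (K * ∑ j ∈ Finset.Ico m (m + n), 1 / ((j : ℝ) + 1) ^ 2) := by
    intro m n
    induction n with
    | zero =>
      simp only [poch_zero, add_zero, Finset.Ico_self, Finset.sum_empty, mul_zero, Real.exp_zero,
        mul_one, norm_one]
      rw [div_self (by positivity), div_self (by positivity), Real.one_rpow, one_mul]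
    | succ n ih =>
      rw [poch_succ, norm_mul, factorial_ratio_succ, ← add_assoc,
        Finset.sum_Ico_succ_top (by omega), mul_add, Real.exp_add]
      have h := hK (m + n)
      have e : z + m + n = z + ((m + n : ℕ) : ℂ) := by push_cast; ring
      rw [e]
      calc _ ≤ _ := mul_le_mul ih h (norm_nonneg _) (by positivity)
        _ = _ := by ring
  refine ⟨Real.exp (|K| * ∑' j : ℕ, 1 / ((j : ℝ) + 1) ^ 2), Real.exp_pos _, fun m n => ?_⟩
  refine (key m n).trans ?_
  rw [mul_comm]
  refine mul_le_mul_of_nonneg_right (Real.exp_le_exp.mpr ?_) (by positivity)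
  refine mul_le_mul (le_abs_self K) ?_ (Finset.sum_nonneg fun _ _ => by positivity) (abs_nonneg K)
  exact summable_one_div_add_one_sq.sum_le_tsum _ fun _ _ => by positivity

lemma exists_norm_poch_le (z : ℂ) : ∃ C : ℝ, 0 < C ∧ ∀ n : ℕ,
    ‖poch z n‖ ≤ C * (n.factorial * ((n : ℝ) + 1) ^ (z.re - 1)) := by
  obtain ⟨C, hC, h⟩ := exists_norm_poch_add_le z
  exact ⟨C, hC, fun n => by simpa using h 0 n⟩

lemma exists_le_norm_poch {z : ℂ} (hz : 0 < z.re) : ∃ C : ℝ, 0 < C ∧ ∀ n : ℕ,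
    C * (n.factorial * ((n : ℝ) + 1) ^ (z.re - 1)) ≤ ‖poch z n‖ := by
  obtain ⟨K, hK⟩ := exists_le_norm_add_natCast hz
  have key : ∀ n : ℕ, n.factorial * ((n : ℝ) + 1) ^ (z.re - 1) *
        Real.exp (-(K * ∑ j ∈ Finset.range n, 1 / ((j : ℝ) + 1) ^ 2)) ≤ ‖poch z n‖ := by
    intro n
    induction n with
    | zero => simp
    | succ n ih =>
      have h := factorial_ratio_succ 0 n (z.re - 1)
      simp only [zero_add, Nat.factorial_zero, Nat.cast_one, Nat.cast_zero, div_one] at h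
      rw [poch_succ, norm_mul, h, Finset.sum_range_succ, mul_add, neg_add, Real.exp_add]
      calc _ = _ := by ring
        _ ≤ _ := mul_le_mul ih (hK n) (by positivity) (norm_nonneg _)
  refine ⟨Real.exp (-(|K| * ∑' j : ℕ, 1 / ((j : ℝ) + 1) ^ 2)), Real.exp_pos _, fun n => ?_⟩
  refine le_trans ?_ (key n)
  rw [mul_comm]
  refine mul_le_mul_of_nonneg_left (Real.exp_le_exp.mpr (neg_le_neg ?_)) (by positivity)
  refine mul_le_mul (le_abs_self K) ?_ (Finset.sum_nonneg fun _ _ => by positivity) (abs_nonneg K)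
  exact summable_one_div_add_one_sq.sum_le_tsum _ fun _ _ => by positivity

lemma exists_inv_norm_poch_le {z : ℂ} (hz : 0 < z.re) : ∃ C : ℝ, 0 < C ∧ ∀ n : ℕ,
    ‖poch z n‖⁻¹ ≤ C * (((n : ℝ) + 1) ^ (1 - z.re) / n.factorial) := by
  obtain ⟨C, hC, h⟩ := exists_le_norm_poch hz
  refine ⟨C⁻¹, inv_pos.mpr hC, fun n => ?_⟩
  have h1 : 0 < C * (n.factorial * ((n : ℝ) + 1) ^ (z.re - 1)) := by positivity
  refine (inv_anti₀ h1 (h n)).trans (le_of_eq ?_)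
  rw [mul_inv, mul_inv, ← Real.rpow_neg (by positivity), neg_sub]
  field_simp

/-- As `1 / Γ` is entire, no restriction on `c` is needed. -/
lemma exists_norm_inv_Gamma_add_le (c : ℂ) : ∃ C : ℝ, 0 < C ∧ ∀ n : ℕ,
    ‖(Complex.Gamma (c + n))⁻¹‖ ≤ C * (((n : ℝ) + 1) ^ (1 - c.re) / n.factorial) := by
  -- shift into the right half plane, where `(c + k)_n` is bounded below
  obtain ⟨k, hk⟩ := exists_nat_gt (-c.re)
  have hck : 0 < (c + k).re := by simp; linarith
  obtain ⟨C₁, hC₁, h₁⟩ := exists_inv_norm_poch_le hck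
  have hG : 0 < ‖(Complex.Gamma (c + k))⁻¹‖ := by
    simpa using Complex.Gamma_ne_zero_of_re_pos hck
  have hkk : ∀ n : ℕ, ‖poch (c + n) k‖ ≤ (‖c‖ + k + 1) ^ k * ((n : ℝ) + 1) ^ k := by
    intro n
    have : ∀ i ≤ k, ‖poch (c + n) i‖ ≤ ((‖c‖ + k + 1) * ((n : ℝ) + 1)) ^ i := by
      intro i
      induction i with
      | zero => simp
      | succ i ih =>
        intro hi
        rw [poch_succ, norm_mul, pow_succ]
        refine mul_le_mul (ih (by omega)) ?_ (norm_nonneg _) (by positivity)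
        have e1 : ‖c + n + i‖ ≤ ‖c‖ + n + i := by
          refine (norm_add_le _ _).trans ?_
          have := norm_add_le c (n : ℂ)
          simp only [Complex.norm_natCast] at this ⊢
          linarith
        have e2 : (i : ℝ) ≤ k := by exact_mod_cast (by omega : i ≤ k)
        have e3 : (0 : ℝ) ≤ n := Nat.cast_nonneg n
        have e4 : (0 : ℝ) ≤ k := Nat.cast_nonneg k
        nlinarith [norm_nonneg c, mul_nonneg (norm_nonneg c) e3, mul_nonneg e4 e3]
    simpa [mul_pow] using this k le_rfl
  refine ⟨(‖c‖ + k + 1) ^ k * C₁ * ‖(Complex.Gamma (c + k))⁻¹‖, by positivity, fun n => ?_⟩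
  have e : (Complex.Gamma (c + n))⁻¹ =
      poch (c + n) k * (poch (c + k) n)⁻¹ * (Complex.Gamma (c + k))⁻¹ := by
    rw [inv_Gamma_eq_poch_mul (c + n) k, inv_Gamma_eq_poch_mul (c + k) n]
    have := poch_ne_zero (ne_neg_natCast_of_re_pos hck) n
    rw [add_right_comm c]
    field_simp
  rw [e, norm_mul, norm_mul, norm_inv (poch _ _)]
  have hpow : ((n : ℝ) + 1) ^ k * ((n : ℝ) + 1) ^ (1 - (c + k).re) =
      ((n : ℝ) + 1) ^ (1 - c.re) := by
    rw [← Real.rpow_natCast, ← Real.rpow_add (by positivity)]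
    congr 1; simp; ring
  calc _ ≤ ((‖c‖ + k + 1) ^ k * ((n : ℝ) + 1) ^ k) *
        (C₁ * (((n : ℝ) + 1) ^ (1 - (c + k).re) / n.factorial)) * ‖(Complex.Gamma (c + k))⁻¹‖ := by
        gcongr
        · exact hkk n
        · exact h₁ n
    _ = _ := by rw [← hpow]; ring

/-! ### Gauss's summation theorem -/

lemma exists_norm_gauss_term_le (a b c : ℂ) : ∃ C : ℝ, 0 < C ∧ ∀ n : ℕ,
    ‖poch a n * poch b n * (Complex.Gamma (c + n))⁻¹ / n.factorial‖ ≤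
      C * ((n : ℝ) + 1) ^ ((a + b - c).re - 1) := by
  obtain ⟨A, hA, h₁⟩ := exists_norm_poch_le a
  obtain ⟨B, hB, h₂⟩ := exists_norm_poch_le b
  obtain ⟨D, hD, h₃⟩ := exists_norm_inv_Gamma_add_le c
  refine ⟨A * B * D, by positivity, fun n => ?_⟩
  rw [norm_div, norm_mul, norm_mul, Complex.norm_natCast]
  have hn : (0 : ℝ) < n.factorial := by positivity
  have hpow : ((n : ℝ) + 1) ^ ((a + b - c).re - 1) =
      ((n : ℝ) + 1) ^ (a.re - 1) * ((n : ℝ) + 1) ^ (b.re - 1) * ((n : ℝ) + 1) ^ (1 - c.re) := by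
    rw [← Real.rpow_add (by positivity), ← Real.rpow_add (by positivity)]
    congr 1; simp; ring
  calc _ ≤ (A * (n.factorial * ((n : ℝ) + 1) ^ (a.re - 1))) *
        (B * (n.factorial * ((n : ℝ) + 1) ^ (b.re - 1))) *
        (D * (((n : ℝ) + 1) ^ (1 - c.re) / n.factorial)) / n.factorial := by
        gcongr
        exacts [h₁ n, h₂ n, h₃ n]
    _ = _ := by rw [hpow]; field_simp

lemma summable_natCast_add_one_rpow {s : ℝ} (hs : s < -1) :
    Summable fun n : ℕ => ((n : ℝ) + 1) ^ s := by
  have := (summable_nat_add_iff 1).mpr (Real.summable_nat_rpow.mpr hs)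
  simpa using this

lemma summable_gauss_term {a b c : ℂ} (h : 0 < (c - a - b).re) :
    Summable fun n : ℕ => poch a n * poch b n * (Complex.Gamma (c + n))⁻¹ / n.factorial := by
  obtain ⟨C, -, hC⟩ := exists_norm_gauss_term_le a b c
  refine Summable.of_norm_bounded ((summable_natCast_add_one_rpow ?_).mul_left C) hC
  simp at h ⊢; linarith

open Filter Topology in
/-- Contiguous relation for the regularised `₂F₁` at `1`. With `T n` the terms of the left-hand
series, the difference of the two sides telescopes to `n * T n`. -/
lemma gauss_contiguous {a b c : ℂ} (h : 0 < (c - a - b).re) :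
    (c - a - b) * ∑' n : ℕ, poch a n * poch b n * (Complex.Gamma (c + n))⁻¹ / n.factorial =
      (c - a) * (c - b) *
        ∑' n : ℕ, poch a n * poch b n * (Complex.Gamma (c + 1 + n))⁻¹ / n.factorial := by
  have h' : 0 < (c + 1 - a - b).re := by simp at h ⊢; linarith
  have hs := summable_gauss_term h
  have hs' := summable_gauss_term h'
  set T := fun n : ℕ => poch a n * poch b n * (Complex.Gamma (c + n))⁻¹ / n.factorial
  set τ := fun n : ℕ => poch a n * poch b n * (Complex.Gamma (c + 1 + n))⁻¹ / n.factorial with hτ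
  have hT : ∀ n, T n = (c + n) * τ n := by
    intro n
    simp only [T, τ]
    rw [Complex.one_div_Gamma_eq_self_mul_one_div_Gamma_add_one (c + n), add_right_comm c]
    ring
  have hstep : ∀ n : ℕ, ((n + 1 : ℕ) : ℂ) * T (n + 1) = (a + n) * (b + n) * τ n := by
    intro n
    simp only [T, τ]
    rw [poch_succ, poch_succ, Nat.factorial_succ]
    have : ((n.factorial : ℕ) : ℂ) ≠ 0 := by exact_mod_cast n.factorial_ne_zero
    have h2 : (n : ℂ) + 1 ≠ 0 := by exact_mod_cast n.succ_ne_zero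
    have e : c + ((n + 1 : ℕ) : ℂ) = c + 1 + n := by push_cast; ring
    rw [e]; push_cast
    field_simp
  have hpart : ∀ N : ℕ, ∑ n ∈ Finset.range N, ((c - a - b) * T n - (c - a) * (c - b) * τ n) =
      -((N : ℂ) * T N) := by
    intro N
    induction N with
    | zero => simp
    | succ N ih =>
      rw [Finset.sum_range_succ, ih, hstep, hT]; ring
  have hlim : Tendsto (fun N : ℕ => -((N : ℂ) * T N)) atTop (𝓝 0) := by
    rw [← neg_zero]
    refine Tendsto.neg ?_
    obtain ⟨C, hC0, hC⟩ := exists_norm_gauss_term_le a b c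
    refine squeeze_zero_norm (a := fun n : ℕ => C * ((n : ℝ) + 1) ^ (-(c - a - b).re)) ?_ ?_
    · intro n
      rw [norm_mul, Complex.norm_natCast]
      have e : ((n : ℝ) + 1) ^ (-(c - a - b).re) =
          ((n : ℝ) + 1) * ((n : ℝ) + 1) ^ ((a + b - c).re - 1) := by
        conv_rhs => enter [1]; rw [← Real.rpow_one ((n : ℝ) + 1)]
        rw [← Real.rpow_add (by positivity)]
        congr 1; simp; ring
      rw [e]
      calc _ ≤ ((n : ℝ) + 1) * (C * ((n : ℝ) + 1) ^ ((a + b - c).re - 1)) := by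
            gcongr
            · linarith
            · exact hC n
        _ = _ := by ring
    · rw [← mul_zero C]
      refine Tendsto.const_mul C ?_
      exact (tendsto_rpow_neg_atTop h).comp
        (tendsto_atTop_add_const_right _ 1 tendsto_natCast_atTop_atTop)
  have hsum :=
    ((hs.mul_left (c - a - b)).sub (hs'.mul_left ((c - a) * (c - b)))).hasSum.tendsto_sum_nat
  simp only [hpart] at hsum
  have := tendsto_nhds_unique hsum hlim
  rw [Summable.tsum_sub (hs.mul_left _) (hs'.mul_left _), tsum_mul_left, tsum_mul_left,
    sub_eq_zero] at this
  exact this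

open Filter Topology in
/-- `Γ (z + k + 1) ∼ k ^ z k!`. -/
lemma tendsto_natCast_cpow_mul_factorial_div_Gamma {z : ℂ} (hz : 0 < z.re) :
    Tendsto (fun k : ℕ => (k : ℂ) ^ z * k.factorial / Complex.Gamma (z + (k + 1 : ℕ)))
      atTop (𝓝 1) := by
  have h := (Complex.GammaSeq_tendsto_Gamma z).div_const (Complex.Gamma z)
  have hG := Complex.Gamma_ne_zero_of_re_pos hz
  rw [div_self hG] at h
  refine h.congr fun k => ?_
  rw [Gamma_add_natCast (ne_neg_natCast_of_re_pos hz), Complex.GammaSeq]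
  have e : ∀ k : ℕ, poch z k = ∏ j ∈ Finset.range k, (z + j) := by
    intro k
    induction k with
    | zero => simp
    | succ k ih => rw [poch_succ, ih, Finset.prod_range_succ]
  rw [e, div_div]

open Filter Topology in
lemma tendsto_tsum_poch_div_one {a b c : ℂ} (hc : 0 < c.re) (h : 0 < (c - a - b).re) :
    Tendsto (fun k : ℕ => ∑' n : ℕ, poch a n * poch b n / poch (c + k) n / n.factorial)
      atTop (𝓝 1) := by
  have hG := Complex.Gamma_ne_zero_of_re_pos hc
  have hs : Summable fun n : ℕ => ‖poch a n * poch b n / poch c n / n.factorial‖ := by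
    refine (((summable_gauss_term h).mul_left (Complex.Gamma c)).norm).congr fun n => ?_
    rw [Gamma_add_natCast (ne_neg_natCast_of_re_pos hc)]
    have := poch_ne_zero (ne_neg_natCast_of_re_pos hc) n
    congr 1; field_simp
  -- since `re c > 0`, shifting `c` to the right only enlarges the denominators
  have hmono : ∀ k n : ℕ, ‖poch c n‖ ≤ ‖poch (c + k) n‖ := by
    intro k n
    induction n with
    | zero => simp
    | succ n ih =>
      rw [poch_succ, poch_succ, norm_mul, norm_mul]
      refine mul_le_mul ih ?_ (norm_nonneg _) (norm_nonneg _)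
      rw [Complex.norm_def, Complex.norm_def]
      refine Real.sqrt_le_sqrt ?_
      rw [Complex.normSq_apply, Complex.normSq_apply]
      simp only [Complex.add_re, Complex.natCast_re, Complex.add_im, Complex.natCast_im, add_zero]
      have h1 : (0 : ℝ) ≤ k := Nat.cast_nonneg k
      have h2 : (0 : ℝ) ≤ n := Nat.cast_nonneg n
      nlinarith
  have key := tendsto_tsum_of_dominated_convergence (𝓕 := atTop)
    (f := fun (k n : ℕ) => poch a n * poch b n / poch (c + k) n / n.factorial)
    (g := fun n : ℕ => if n = 0 then (1 : ℂ) else 0) hs ?_ ?_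
  · simpa using key
  · intro n
    rcases n with _ | n
    · simp
    · simp only [Nat.succ_ne_zero, if_false]
      rw [← zero_div (((n + 1).factorial : ℕ) : ℂ)]
      refine Tendsto.div_const ?_ _
      have hp : 0 < ‖poch c n‖ := norm_pos_iff.mpr (poch_ne_zero (ne_neg_natCast_of_re_pos hc) n)
      refine squeeze_zero_norm' ?_
        (tendsto_const_div_atTop_nhds_zero_nat (‖poch a (n + 1) * poch b (n + 1)‖ / ‖poch c n‖))
      filter_upwards [eventually_gt_atTop 0] with k hk
      rw [norm_div, div_div, poch_succ (c + k), norm_mul (poch (c + k) n)]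
      have hk' : (0 : ℝ) < k := by exact_mod_cast hk
      have h1 : (k : ℝ) ≤ ‖c + k + n‖ := by
        refine le_trans ?_ (Complex.re_le_norm _)
        simp; have : (0 : ℝ) ≤ n := Nat.cast_nonneg n
        linarith
      gcongr
      exact hmono k n
  · refine Eventually.of_forall fun k n => ?_
    rw [norm_div, norm_div, norm_div, norm_div]
    have : 0 < ‖poch c n‖ := norm_pos_iff.mpr (poch_ne_zero (ne_neg_natCast_of_re_pos hc) n)
    gcongr
    exact hmono k n

open Filter Topology in
/-- Gauss's theorem `₂F₁(a, b; c; 1) = Γ(c) Γ(c - a - b) / (Γ(c - a) Γ(c - b))`, divided by `Γ(c)`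
so that `c` may be any complex number (`1 / Γ` vanishes at the poles of `Γ`). -/
theorem hasSum_gauss {a b c : ℂ} (h : 0 < (c - a - b).re) :
    HasSum (fun n : ℕ => poch a n * poch b n * (Complex.Gamma (c + n))⁻¹ / n.factorial)
      (Complex.Gamma (c - a - b) / (Complex.Gamma (c - a) * Complex.Gamma (c - b))) := by
  set S : ℂ → ℂ := fun c =>
    ∑' n : ℕ, poch a n * poch b n * (Complex.Gamma (c + n))⁻¹ / n.factorial with hS
  set r : ℂ → ℂ := fun c =>
    Complex.Gamma (c - a - b) / (Complex.Gamma (c - a) * Complex.Gamma (c - b)) with hr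
  have hr_step : ∀ c : ℂ, 0 < (c - a - b).re →
      (c - a - b) * r c = (c - a) * (c - b) * r (c + 1) := by
    intro c hc
    have h0 : c - a - b ≠ 0 := by rintro h0; rw [h0] at hc; simp at hc
    have e1 := Complex.one_div_Gamma_eq_self_mul_one_div_Gamma_add_one (c - a)
    have e2 := Complex.one_div_Gamma_eq_self_mul_one_div_Gamma_add_one (c - b)
    have e3 := Complex.Gamma_add_one _ h0
    simp only [hr, div_eq_mul_inv, mul_inv]
    rw [e1, e2, show c + 1 - a - b = c - a - b + 1 by ring, e3,
      show c + 1 - a = c - a + 1 by ring, show c + 1 - b = c - b + 1 by ring]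
    ring
  -- the two sides agree at `c` as soon as they agree at `c + 1`
  have hdesc : ∀ c : ℂ, 0 < (c - a - b).re → S (c + 1) = r (c + 1) → S c = r c := by
    intro c hc he
    have h0 : c - a - b ≠ 0 := by rintro h0; rw [h0] at hc; simp at hc
    have h1 := gauss_contiguous hc
    have h2 := hr_step c hc
    rw [← he] at h2
    exact mul_left_cancel₀ h0 (h1.trans h2.symm)
  have hdesc' : ∀ (k : ℕ) (c : ℂ), 0 < (c - a - b).re → S (c + k) = r (c + k) → S c = r c := by
    intro k
    induction k with
    | zero => intro c _ he; simpa using he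
    | succ k ih =>
      intro c hc he
      refine ih c hc (hdesc (c + k) ?_ ?_)
      · have : (0 : ℝ) ≤ k := Nat.cast_nonneg k
        simp at hc ⊢; linarith
      · rw [add_assoc c]; exact_mod_cast he
  suffices hmain : S c = r c by
    have := (summable_gauss_term h).hasSum
    rwa [show (∑' n : ℕ, poch a n * poch b n * (Complex.Gamma (c + n))⁻¹ / n.factorial) = r c from
      hmain] at this
  -- it is therefore enough to treat `c` with large real part
  obtain ⟨k, hk⟩ := exists_nat_gt (|c.re| + |a.re| + |b.re|)
  refine hdesc' k c h ?_
  set d := c + k with hd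
  have hre : d.re = c.re + k := by simp [hd]
  have n1 := neg_abs_le c.re
  have n2 := le_abs_self a.re
  have n3 := le_abs_self b.re
  have n4 := abs_nonneg a.re
  have n5 := abs_nonneg b.re
  have d0 : 0 < d.re := by linarith
  have d1 : 0 < (d - a).re := by simp only [Complex.sub_re]; linarith
  have d2 : 0 < (d - b).re := by simp only [Complex.sub_re]; linarith
  have d3 : 0 < (d - a - b).re := by simp only [Complex.sub_re]; linarith
  -- both sides satisfy the same first order recurrence, and `Γ (d + k)` times either tends to `1`
  have hrec : ∀ k : ℕ, S d * r (d + k) = r d * S (d + k) := by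
    intro k
    induction k with
    | zero => simp [mul_comm]
    | succ k ih =>
      have hk : 0 < (d + k - a - b).re := by
        have : (0 : ℝ) ≤ k := Nat.cast_nonneg k
        simp at d3 ⊢; linarith
      have q1 : 0 < (d + k - a).re := by
        have : (0 : ℝ) ≤ k := Nat.cast_nonneg k
        simp at d1 ⊢; linarith
      have q2 : 0 < (d + k - b).re := by
        have : (0 : ℝ) ≤ k := Nat.cast_nonneg k
        simp at d2 ⊢; linarith
      have h1 := gauss_contiguous hk
      have h2 := hr_step _ hk
      have z1 : d + k - a ≠ 0 := by intro h0; rw [h0] at q1; simp at q1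
      have z2 : d + k - b ≠ 0 := by intro h0; rw [h0] at q2; simp at q2
      have h1' : (d + k - a - b) * S (d + k) = (d + k - a) * (d + k - b) * S (d + k + 1) := h1
      have e : d + ((k + 1 : ℕ) : ℂ) = d + k + 1 := by push_cast; ring
      rw [e]
      refine mul_left_cancel₀ (mul_ne_zero z1 z2) ?_
      linear_combination (d + k - a - b) * ih - S d * h2 + r d * h1'
  have lim1 : Tendsto (fun k : ℕ => Complex.Gamma (d + k) * S (d + k)) atTop (𝓝 1) := by
    refine (tendsto_tsum_poch_div_one (a := a) (b := b) d0 d3).congr fun k => ?_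
    rw [hS, ← tsum_mul_left]
    refine tsum_congr fun n => ?_
    have hp : 0 < (d + k).re := by
      have : (0 : ℝ) ≤ k := Nat.cast_nonneg k
      simp at d0 ⊢; linarith
    have := Complex.Gamma_ne_zero_of_re_pos hp
    rw [Gamma_add_natCast (ne_neg_natCast_of_re_pos hp)]
    field_simp
  have lim2 : Tendsto (fun k : ℕ => Complex.Gamma (d + (k + 1 : ℕ)) * r (d + (k + 1 : ℕ)))
      atTop (𝓝 1) := by
    have t := ((tendsto_natCast_cpow_mul_factorial_div_Gamma d1).mul
      (tendsto_natCast_cpow_mul_factorial_div_Gamma d2)).div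
      ((tendsto_natCast_cpow_mul_factorial_div_Gamma d0).mul
      (tendsto_natCast_cpow_mul_factorial_div_Gamma d3)) (by norm_num)
    simp only [mul_one, div_one] at t
    refine t.congr' ?_
    filter_upwards [eventually_gt_atTop 0] with k hk
    have hk0 : (k : ℂ) ≠ 0 := by exact_mod_cast hk.ne'
    have e : (k : ℂ) ^ (d - a) * (k : ℂ) ^ (d - b) = (k : ℂ) ^ d * (k : ℂ) ^ (d - a - b) := by
      rw [← Complex.cpow_add _ _ hk0, ← Complex.cpow_add _ _ hk0]; congr 1; ring
    have f0 : (k.factorial : ℂ) ≠ 0 := by exact_mod_cast k.factorial_ne_zero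
    have p0 : (k : ℂ) ^ d ≠ 0 := by simp [Complex.cpow_eq_zero_iff, hk0]
    have p1 : (k : ℂ) ^ (d - a - b) ≠ 0 := by simp [Complex.cpow_eq_zero_iff, hk0]
    simp only [hr]
    rw [show d + ((k + 1 : ℕ) : ℂ) - a - b = d - a - b + (k + 1 : ℕ) by ring,
      show d + ((k + 1 : ℕ) : ℂ) - a = d - a + (k + 1 : ℕ) by ring,
      show d + ((k + 1 : ℕ) : ℂ) - b = d - b + (k + 1 : ℕ) by ring]
    simp only [Pi.div_apply]
    rw [div_mul_div_comm, div_mul_div_comm, div_div_div_eq]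
    rw [show (k : ℂ) ^ (d - a) * k.factorial * ((k : ℂ) ^ (d - b) * k.factorial) =
      (k : ℂ) ^ (d - a) * (k : ℂ) ^ (d - b) * (k.factorial * k.factorial) by ring, e]
    field_simp
  have lim1' := lim1.comp (tendsto_add_atTop_nat 1)
  have l3 := lim2.const_mul (S d)
  have l4 := lim1'.const_mul (r d)
  have heq : ∀ k : ℕ, S d * (Complex.Gamma (d + (k + 1 : ℕ)) * r (d + (k + 1 : ℕ))) =
      r d * ((fun k : ℕ => Complex.Gamma (d + k) * S (d + k)) ∘ fun a => a + 1) k := by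
    intro k
    simp only [Function.comp]
    linear_combination Complex.Gamma (d + (k + 1 : ℕ)) * hrec (k + 1)
  simp only [heq] at l3
  have := tendsto_nhds_unique l3 l4
  simpa using this

/-! ### Double power series with coefficients of polynomial growth -/

/-- Polynomial growth of the coefficients gives absolute convergence in the unit bidisc. -/
lemma summable_norm_mul_pow_of_growth {C : ℕ × ℕ → ℂ} {K : ℝ} {k : ℕ}
    (h : ∀ p, ‖C p‖ ≤ K * (((p.1 : ℝ) + 1) ^ k * ((p.2 : ℝ) + 1) ^ k)) {x y : ℝ}
    (hx0 : 0 ≤ x) (hx : x < 1) (hy0 : 0 ≤ y) (hy : y < 1) :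
    Summable fun p : ℕ × ℕ => ‖C p‖ * x ^ p.1 * y ^ p.2 := by
  have hs : ∀ z : ℝ, 0 ≤ z → z < 1 → Summable fun n : ℕ => ((n : ℝ) + 1) ^ k * z ^ n := by
    intro z hz0 hz
    rcases hz0.eq_or_lt with rfl | hz0
    · refine summable_of_ne_finset_zero (s := {0}) fun n hn => ?_
      simp at hn; simp [hn]
    have := summable_pow_mul_geometric_of_norm_lt_one k (r := z)
      (by rwa [Real.norm_eq_abs, abs_of_pos hz0])
    refine (((summable_nat_add_iff 1).mpr this).mul_left z⁻¹).congr fun n => ?_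
    push_cast; field_simp; ring
  refine Summable.of_nonneg_of_le (fun p => by positivity) (fun p => ?_)
    (((hs x hx0 hx).mul_of_nonneg (hs y hy0 hy) (fun _ => by positivity)
      (fun _ => by positivity)).mul_left K)
  calc _ ≤ (K * (((p.1 : ℝ) + 1) ^ k * ((p.2 : ℝ) + 1) ^ k)) * x ^ p.1 * y ^ p.2 := by
        gcongr; exact h p
    _ = _ := by ring

lemma summable_mul_pow_of_growth {C : ℕ × ℕ → ℂ} {K : ℝ} {k : ℕ}
    (h : ∀ p, ‖C p‖ ≤ K * (((p.1 : ℝ) + 1) ^ k * ((p.2 : ℝ) + 1) ^ k)) {X Y : ℂ}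
    (hX : ‖X‖ < 1) (hY : ‖Y‖ < 1) :
    Summable fun p : ℕ × ℕ => C p * X ^ p.1 * Y ^ p.2 := by
  refine Summable.of_norm ?_
  simpa using summable_norm_mul_pow_of_growth h (norm_nonneg X) hX (norm_nonneg Y) hY

lemma differentiableOn_tsum_mul_pow_of_growth {C : ℕ × ℕ → ℂ} {K : ℝ} {k : ℕ}
    (h : ∀ p, ‖C p‖ ≤ K * (((p.1 : ℝ) + 1) ^ k * ((p.2 : ℝ) + 1) ^ k)) {X : ℂ}
    (hX : ‖X‖ < 1) :
    DifferentiableOn ℂ (fun Y => ∑' p : ℕ × ℕ, C p * X ^ p.1 * Y ^ p.2) (Metric.ball 0 1) := by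
  intro Y hY
  rw [mem_ball_zero_iff] at hY
  obtain ⟨r, hYr, hr⟩ := exists_between hY
  have hr0 : 0 ≤ r := (norm_nonneg Y).trans hYr.le
  have := Complex.differentiableOn_tsum_of_summable_norm
    (summable_norm_mul_pow_of_growth h (norm_nonneg X) hX hr0 hr)
    (F := fun p Y => C p * X ^ p.1 * Y ^ p.2) (U := Metric.ball 0 r)
    (fun p => (Differentiable.differentiableOn (by fun_prop))) Metric.isOpen_ball ?_
  · exact (this.differentiableAt (Metric.isOpen_ball.mem_nhds
      (by rwa [mem_ball_zero_iff]))).differentiableWithinAt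
  · intro p w hw
    rw [mem_ball_zero_iff] at hw
    rw [norm_mul, norm_mul, norm_pow, norm_pow]
    gcongr

/-- Any product of real powers of `m + 1`, `n + 1` and `m + n + 1` has polynomial growth. -/
lemma exists_rpow_triple_le (P Q R : ℝ) : ∃ k : ℕ, ∀ m n : ℕ,
    ((m : ℝ) + 1) ^ P * ((n : ℝ) + 1) ^ Q * (((m + n : ℕ) : ℝ) + 1) ^ R ≤
      ((m : ℝ) + 1) ^ k * ((n : ℝ) + 1) ^ k := by
  obtain ⟨k, hk⟩ := exists_nat_ge (|P| + |Q| + |R|)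
  refine ⟨k, fun m n => ?_⟩
  have hm : (0 : ℝ) ≤ m := Nat.cast_nonneg m
  have hn : (0 : ℝ) ≤ n := Nat.cast_nonneg n
  have h1 : (((m + n : ℕ) : ℝ) + 1) ^ R ≤ ((m : ℝ) + 1) ^ |R| * ((n : ℝ) + 1) ^ |R| := by
    rw [← Real.mul_rpow (by positivity) (by positivity)]
    calc _ ≤ (((m + n : ℕ) : ℝ) + 1) ^ |R| :=
          Real.rpow_le_rpow_of_exponent_le (by push_cast; linarith) (le_abs_self R)
      _ ≤ _ := Real.rpow_le_rpow (by positivity) (by push_cast; nlinarith) (abs_nonneg R)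
  have h2 : ∀ (j : ℕ) (s : ℝ), s ≤ |P| + |Q| → ((j : ℝ) + 1) ^ s * ((j : ℝ) + 1) ^ |R| ≤
      ((j : ℝ) + 1) ^ k := by
    intro j s hs
    have hj : (0 : ℝ) ≤ j := Nat.cast_nonneg j
    rw [← Real.rpow_add (by positivity), ← Real.rpow_natCast]
    exact Real.rpow_le_rpow_of_exponent_le (by linarith) (by linarith)
  calc _ ≤ ((m : ℝ) + 1) ^ P * ((n : ℝ) + 1) ^ Q *
        (((m : ℝ) + 1) ^ |R| * ((n : ℝ) + 1) ^ |R|) := by gcongr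
    _ = (((m : ℝ) + 1) ^ P * ((m : ℝ) + 1) ^ |R|) * (((n : ℝ) + 1) ^ Q * ((n : ℝ) + 1) ^ |R|) := by
        ring
    _ ≤ _ := by
        refine mul_le_mul (h2 m P ?_) (h2 n Q ?_) (by positivity) (by positivity)
        · linarith [le_abs_self P, abs_nonneg Q]
        · linarith [le_abs_self Q, abs_nonneg P]

/-! ### The coefficients of `F₃` and of its Pfaff transform -/

/-- The coefficients of the double series of `F₃`. -/
noncomputable def appellF3Coeff (a a' b b' c : ℂ) (p : ℕ × ℕ) : ℂ :=
  poch a p.1 * poch a' p.2 * poch b p.1 * poch b' p.2 /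
    (poch c (p.1 + p.2) * (p.1.factorial : ℂ) * (p.2.factorial : ℂ))

/-- The coefficients of the double series in `X` and `Y / (Y - 1)` obtained from `F₃` by applying
Pfaff's transformation to the sum over the second index. -/
noncomputable def pfaffCoeff (a a' b b' c : ℂ) (p : ℕ × ℕ) : ℂ :=
  poch a p.1 * poch b p.1 * poch a' p.2 * poch (c - b' + p.1) p.2 /
    (poch c (p.1 + p.2) * (p.1.factorial : ℂ) * (p.2.factorial : ℂ))

lemma exists_norm_pfaffCoeff_le (a a' b b' : ℂ) {c : ℂ} (hc : 0 < c.re) :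
    ∃ C : ℝ, 0 < C ∧ ∀ p : ℕ × ℕ, ‖pfaffCoeff a a' b b' c p‖ ≤
      C * (((p.1 : ℝ) + 1) ^ ((a + b - c + b').re - 1) * ((p.2 : ℝ) + 1) ^ (a'.re - 1) *
        (((p.1 + p.2 : ℕ) : ℝ) + 1) ^ (-b'.re)) := by
  obtain ⟨A, hA, h₁⟩ := exists_norm_poch_le a
  obtain ⟨B, hB, h₂⟩ := exists_norm_poch_le b
  obtain ⟨A', hA', h₃⟩ := exists_norm_poch_le a'
  obtain ⟨B', hB', h₄⟩ := exists_norm_poch_add_le (c - b')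
  obtain ⟨D, hD, h₅⟩ := exists_inv_norm_poch_le hc
  refine ⟨A * B * A' * B' * D, by positivity, fun ⟨m, n⟩ => ?_⟩
  simp only [pfaffCoeff]
  rw [norm_div, norm_mul, norm_mul, norm_mul, norm_mul, norm_mul, Complex.norm_natCast,
    Complex.norm_natCast, div_eq_mul_inv, mul_inv, mul_inv]
  have e1 : ((m : ℝ) + 1) ^ ((a + b - c + b').re - 1) = ((m : ℝ) + 1) ^ (a.re - 1) *
      ((m : ℝ) + 1) ^ (b.re - 1) * ((m : ℝ) + 1) ^ (-((c - b').re - 1)) := by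
    rw [← Real.rpow_add (by positivity), ← Real.rpow_add (by positivity)]
    congr 1; simp; ring
  have e2 : (((m + n : ℕ) : ℝ) + 1) ^ (-b'.re) = (((m + n : ℕ) : ℝ) + 1) ^ ((c - b').re - 1) *
      (((m + n : ℕ) : ℝ) + 1) ^ (1 - c.re) := by
    rw [← Real.rpow_add (by positivity)]
    congr 1; simp
  have e3 : ((((m + n : ℕ) : ℝ) + 1) / ((m : ℝ) + 1)) ^ ((c - b').re - 1) =
      (((m + n : ℕ) : ℝ) + 1) ^ ((c - b').re - 1) * ((m : ℝ) + 1) ^ (-((c - b').re - 1)) := by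
    rw [Real.div_rpow (by positivity) (by positivity), Real.rpow_neg (by positivity)]
    rfl
  calc _ ≤ (A * (m.factorial * ((m : ℝ) + 1) ^ (a.re - 1))) *
        (B * (m.factorial * ((m : ℝ) + 1) ^ (b.re - 1))) *
        (A' * (n.factorial * ((n : ℝ) + 1) ^ (a'.re - 1))) *
        (B' * ((m + n).factorial / m.factorial *
          ((((m + n : ℕ) : ℝ) + 1) / (m + 1)) ^ ((c - b').re - 1))) *
        ((D * ((((m + n : ℕ) : ℝ) + 1) ^ (1 - c.re) / (m + n).factorial)) *
          (m.factorial : ℝ)⁻¹ * (n.factorial : ℝ)⁻¹) := by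
        gcongr
        exacts [h₁ m, h₂ m, h₃ n, h₄ m n, h₅ (m + n)]
    _ = _ := by rw [e1, e2, e3]; field_simp

lemma exists_norm_appellF3Coeff_le (a a' b b' : ℂ) {c : ℂ} (hc : 0 < c.re) :
    ∃ C : ℝ, 0 < C ∧ ∀ p : ℕ × ℕ, ‖appellF3Coeff a a' b b' c p‖ ≤
      C * (((p.1 : ℝ) + 1) ^ ((a + b).re - 2) * ((p.2 : ℝ) + 1) ^ ((a' + b').re - 2) *
        (((p.1 + p.2 : ℕ) : ℝ) + 1) ^ (1 - c.re)) := by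
  obtain ⟨A, hA, h₁⟩ := exists_norm_poch_le a
  obtain ⟨B, hB, h₂⟩ := exists_norm_poch_le b
  obtain ⟨A', hA', h₃⟩ := exists_norm_poch_le a'
  obtain ⟨B', hB', h₄⟩ := exists_norm_poch_le b'
  obtain ⟨D, hD, h₅⟩ := exists_inv_norm_poch_le hc
  refine ⟨A * B * A' * B' * D, by positivity, fun ⟨m, n⟩ => ?_⟩
  simp only [appellF3Coeff]
  rw [norm_div, norm_mul, norm_mul, norm_mul, norm_mul, norm_mul, Complex.norm_natCast,
    Complex.norm_natCast, div_eq_mul_inv, mul_inv, mul_inv]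
  have e1 : ∀ (j : ℕ) (u v : ℂ), ((j : ℝ) + 1) ^ ((u + v).re - 2) = ((j : ℝ) + 1) ^ (u.re - 1) *
      ((j : ℝ) + 1) ^ (v.re - 1) := by
    intro j u v
    rw [← Real.rpow_add (by positivity)]
    congr 1; simp; ring
  have hfac : (m.factorial : ℝ) * n.factorial / (m + n).factorial ≤ 1 := by
    rw [div_le_one (by positivity)]
    exact_mod_cast Nat.le_of_dvd (Nat.factorial_pos _)
      (Nat.factorial_mul_factorial_dvd_factorial_add m n)
  calc _ ≤ (A * (m.factorial * ((m : ℝ) + 1) ^ (a.re - 1))) *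
        (A' * (n.factorial * ((n : ℝ) + 1) ^ (a'.re - 1))) *
        (B * (m.factorial * ((m : ℝ) + 1) ^ (b.re - 1))) *
        (B' * (n.factorial * ((n : ℝ) + 1) ^ (b'.re - 1))) *
        ((D * ((((m + n : ℕ) : ℝ) + 1) ^ (1 - c.re) / (m + n).factorial)) *
          (m.factorial : ℝ)⁻¹ * (n.factorial : ℝ)⁻¹) := by
        gcongr
        exacts [h₁ m, h₃ n, h₂ m, h₄ n, h₅ (m + n)]
    _ = (A * B * A' * B' * D * (((m : ℝ) + 1) ^ ((a + b).re - 2) *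
        ((n : ℝ) + 1) ^ ((a' + b').re - 2) * (((m + n : ℕ) : ℝ) + 1) ^ (1 - c.re))) *
        ((m.factorial : ℝ) * n.factorial / (m + n).factorial) := by
        rw [e1, e1]; field_simp
    _ ≤ _ := mul_le_of_le_one_right (by positivity) hfac

lemma exists_pfaffCoeff_growth (a a' b b' : ℂ) {c : ℂ} (hc : 0 < c.re) :
    ∃ (K : ℝ) (k : ℕ), ∀ p : ℕ × ℕ, ‖pfaffCoeff a a' b b' c p‖ ≤
      K * (((p.1 : ℝ) + 1) ^ k * ((p.2 : ℝ) + 1) ^ k) := by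
  obtain ⟨C, hC, h⟩ := exists_norm_pfaffCoeff_le a a' b b' hc
  obtain ⟨k, hk⟩ := exists_rpow_triple_le ((a + b - c + b').re - 1) (a'.re - 1) (-b'.re)
  exact ⟨C, k, fun p => (h p).trans (mul_le_mul_of_nonneg_left (hk _ _) hC.le)⟩

lemma exists_appellF3Coeff_growth (a a' b b' : ℂ) {c : ℂ} (hc : 0 < c.re) :
    ∃ (K : ℝ) (k : ℕ), ∀ p : ℕ × ℕ, ‖appellF3Coeff a a' b b' c p‖ ≤
      K * (((p.1 : ℝ) + 1) ^ k * ((p.2 : ℝ) + 1) ^ k) := by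
  obtain ⟨C, hC, h⟩ := exists_norm_appellF3Coeff_le a a' b b' hc
  obtain ⟨k, hk⟩ := exists_rpow_triple_le ((a + b).re - 2) ((a' + b').re - 2) (1 - c.re)
  exact ⟨C, k, fun p => (h p).trans (mul_le_mul_of_nonneg_left (hk _ _) hC.le)⟩

/-! ### Pfaff's transformation -/

/-- The Chu-Vandermonde identity, in the form `₂F₁(-N, e - b; e; 1) = (b)_N / (e)_N`. -/
lemma sum_antidiagonal_choose_mul_poch (b : ℂ) (N : ℕ) : ∀ e : ℂ,
    ∑ p ∈ Finset.HasAntidiagonal.antidiagonal N, (N.choose p.1 : ℂ) *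
      ((-1) ^ p.1 * poch (e - b) p.1 * poch (e + p.1) p.2) = poch b N := by
  induction N with
  | zero => intro e; simp
  | succ N ih =>
    intro e
    rw [Finset.sum_antidiagonal_choose_succ_mul
      (fun i j => (-1) ^ i * poch (e - b) i * poch (e + i) j)]
    have h1 : ∑ p ∈ Finset.HasAntidiagonal.antidiagonal N, (N.choose p.1 : ℂ) *
        ((-1) ^ p.1 * poch (e - b) p.1 * poch (e + p.1) (p.2 + 1)) = (e + N) * poch b N := by
      rw [← ih e, Finset.mul_sum]
      refine Finset.sum_congr rfl fun p hp => ?_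
      rw [poch_succ, ← Finset.HasAntidiagonal.mem_antidiagonal.mp hp]; push_cast; ring
    have h2 : ∑ p ∈ Finset.HasAntidiagonal.antidiagonal N, (N.choose p.2 : ℂ) *
        ((-1) ^ (p.1 + 1) * poch (e - b) (p.1 + 1) * poch (e + (p.1 + 1 : ℕ)) p.2) =
          -(e - b) * poch b N := by
      rw [← ih (e + 1), Finset.mul_sum]
      refine Finset.sum_congr rfl fun p hp => ?_
      have hN := Finset.HasAntidiagonal.mem_antidiagonal.mp hp
      rw [Nat.choose_symm_of_eq_add (by omega : N = p.2 + p.1), poch_succ_left, pow_succ]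
      have e1 : e - b + 1 = e + 1 - b := by ring
      have e2 : e + ((p.1 + 1 : ℕ) : ℂ) = e + 1 + p.1 := by push_cast; ring
      rw [e1, e2]; ring
    rw [h1, h2, poch_succ]; ring

lemma ringChoose_eq_poch_div (z : ℂ) (n : ℕ) :
    Ring.choose (z + n - 1) n = poch z n / n.factorial := by
  rw [Ring.choose_eq_smul]
  simp only [Polynomial.descPochhammer_smeval_eq_ascPochhammer,
    Polynomial.ascPochhammer_smeval_cast, Polynomial.ascPochhammer_smeval_eq_eval]
  rw [show z + n - 1 - n + 1 = z by ring, smul_eq_mul, poch]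
  ring

lemma hasSum_poch_div_factorial_mul_pow (z : ℂ) {Y : ℂ} (hY : ‖Y‖ < 1) :
    HasSum (fun n : ℕ => poch z n / n.factorial * Y ^ n) ((1 - Y) ^ (-z)) := by
  have h := (Complex.one_div_one_sub_cpow_hasFPowerSeriesOnBall_zero z).hasSum (y := Y)
    (by simpa [← ofReal_norm] using hY)
  rw [Complex.cpow_neg]
  simp only [zero_add, one_div, FormalMultilinearSeries.ofScalars_apply_eq, smul_eq_mul,
    ringChoose_eq_poch_div] at h
  exact h

/-- The coefficient of `Y ^ N` after expanding the Pfaff transform of `₂F₁(a, b; e; Y)` in powers of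
`Y`. -/
lemma pfaff_coeff_sum (a b : ℂ) {e : ℂ} (he : 0 < e.re) (N : ℕ) :
    ∑ p ∈ Finset.HasAntidiagonal.antidiagonal N, poch a p.1 * poch (e - b) p.1 /
      (poch e p.1 * p.1.factorial) * (-1) ^ p.1 * (poch (a + p.1) p.2 / p.2.factorial) =
    poch a N * poch b N / (poch e N * N.factorial) := by
  have hne := poch_ne_zero (ne_neg_natCast_of_re_pos he)
  rw [← sum_antidiagonal_choose_mul_poch b N e, Finset.mul_sum, Finset.sum_div]
  refine Finset.sum_congr rfl fun p hp => ?_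
  obtain ⟨m, n⟩ := p
  rw [Finset.HasAntidiagonal.mem_antidiagonal] at hp
  simp only at hp ⊢
  subst hp
  have h1 := hne (m + n)
  rw [poch_add] at h1
  have h2 := left_ne_zero_of_mul h1
  have h3 := right_ne_zero_of_mul h1
  rw [Nat.cast_add_choose, poch_add, poch_add e]
  have f0 : ∀ j : ℕ, (j.factorial : ℂ) ≠ 0 := fun j => by exact_mod_cast j.factorial_ne_zero
  have f1 := f0 m
  have f2 := f0 n
  have f3 := f0 (m + n)
  field_simp

lemma one_sub_ne_zero_of_re_lt_half {Y : ℂ} (hY : Y.re < 1 / 2) : 1 - Y ≠ 0 := by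
  intro h
  have : Y = 1 := (sub_eq_zero.mp h).symm
  rw [this] at hY; norm_num at hY

lemma norm_div_sub_one_lt {Y : ℂ} (hY : Y.re < 1 / 2) : ‖Y / (Y - 1)‖ < 1 := by
  have h0 : Y - 1 ≠ 0 := by
    rw [← neg_sub]; exact neg_ne_zero.mpr (one_sub_ne_zero_of_re_lt_half hY)
  rw [norm_div, div_lt_one (norm_pos_iff.mpr h0), Complex.norm_def, Complex.norm_def]
  refine Real.sqrt_lt_sqrt (Complex.normSq_nonneg _) ?_
  rw [Complex.normSq_apply, Complex.normSq_apply]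
  simp
  nlinarith

/-- Pfaff's transformation of `₂F₁(a, b; e; Y)` near `Y = 0`: expand the powers of `1 - Y` by the
binomial series and rearrange. -/
lemma pfaff_transformation (a b : ℂ) {e : ℂ} (he : 0 < e.re) {Y : ℂ} (hY : ‖Y‖ < 1 / 2) :
    (1 - Y) ^ (-a) * ∑' n : ℕ, poch a n * poch (e - b) n / (poch e n * n.factorial) *
      (Y / (Y - 1)) ^ n = ∑' n : ℕ, poch a n * poch b n / (poch e n * n.factorial) * Y ^ n := by
  have hre : Y.re < 1 / 2 := (Complex.re_le_norm Y).trans_lt hY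
  have h1Y := one_sub_ne_zero_of_re_lt_half hre
  have hY1 : Y - 1 ≠ 0 := by rw [← neg_sub]; exact neg_ne_zero.mpr h1Y
  obtain ⟨A, hA, hA'⟩ := exists_norm_poch_le a
  obtain ⟨B, hB, hB'⟩ := exists_norm_poch_le (e - b)
  obtain ⟨D, hD, hD'⟩ := exists_inv_norm_poch_le he
  obtain ⟨E, hE, hE'⟩ := exists_norm_poch_add_le a
  obtain ⟨k, hk⟩ := exists_rpow_triple_le
    ((a.re - 1) + ((e - b).re - 1) + (1 - e.re) + (-(a.re - 1))) 0 (a.re - 1)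
  set c : ℕ → ℂ := fun n => poch a n * poch (e - b) n / (poch e n * n.factorial) with hc
  clear_value c
  -- the binomial coefficient in the rearranged series is absorbed by powers of `2`
  set D2 : ℕ × ℕ → ℂ := fun p => c p.1 * (-1) ^ p.1 * (poch (a + p.1) p.2 / p.2.factorial) *
    ((2 : ℂ)⁻¹ ^ p.1 * (2 : ℂ)⁻¹ ^ p.2) with hD2
  have hbound : ∀ p, ‖D2 p‖ ≤ (A * B * D * E) * (((p.1 : ℝ) + 1) ^ k * ((p.2 : ℝ) + 1) ^ k) := by
    rintro ⟨m, n⟩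
    have hm : ‖c m‖ ≤ A * B * D * ((m : ℝ) + 1) ^ ((a.re - 1) + ((e - b).re - 1) + (1 - e.re)) := by
      simp only [hc]
      rw [norm_div, norm_mul, norm_mul, Complex.norm_natCast, div_eq_mul_inv, mul_inv,
        Real.rpow_add (by positivity), Real.rpow_add (by positivity)]
      have f : (0 : ℝ) < m.factorial := by positivity
      calc _ ≤ (A * (m.factorial * ((m : ℝ) + 1) ^ (a.re - 1))) *
            (B * (m.factorial * ((m : ℝ) + 1) ^ ((e - b).re - 1))) *
            ((D * (((m : ℝ) + 1) ^ (1 - e.re) / m.factorial)) * (m.factorial : ℝ)⁻¹) := by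
            gcongr
            exacts [hA' m, hB' m, hD' m]
        _ = _ := by field_simp
    have hchoose : ((m + n).factorial : ℝ) / (m.factorial * n.factorial) *
        ((2 : ℝ)⁻¹ ^ m * (2 : ℝ)⁻¹ ^ n) ≤ 1 := by
      rw [← pow_add, inv_pow, mul_inv_le_iff₀ (by positivity), one_mul,
        ← Nat.cast_add_choose ℝ]
      exact_mod_cast Nat.choose_le_two_pow (m + n) m
    have e3 : ((((m + n : ℕ) : ℝ) + 1) / ((m : ℝ) + 1)) ^ (a.re - 1) =
        (((m + n : ℕ) : ℝ) + 1) ^ (a.re - 1) * ((m : ℝ) + 1) ^ (-(a.re - 1)) := by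
      rw [Real.div_rpow (by positivity) (by positivity), Real.rpow_neg (by positivity)]
      rfl
    simp only [hD2]
    rw [norm_mul, norm_mul, norm_mul, norm_div, norm_mul, norm_pow, norm_pow, norm_pow, norm_inv,
      norm_neg, norm_one, one_pow, mul_one, Complex.norm_natCast, Complex.norm_ofNat]
    calc _ ≤ A * B * D * ((m : ℝ) + 1) ^ ((a.re - 1) + ((e - b).re - 1) + (1 - e.re)) *
          ((E * ((m + n).factorial / m.factorial *
            ((((m + n : ℕ) : ℝ) + 1) / ((m : ℝ) + 1)) ^ (a.re - 1))) / n.factorial) *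
          ((2 : ℝ)⁻¹ ^ m * (2 : ℝ)⁻¹ ^ n) := by
          gcongr
          exact hE' m n
      _ = A * B * D * E * (((m : ℝ) + 1) ^
            ((a.re - 1) + ((e - b).re - 1) + (1 - e.re) + (-(a.re - 1))) * ((n : ℝ) + 1) ^ (0 : ℝ) *
            (((m + n : ℕ) : ℝ) + 1) ^ (a.re - 1)) *
            (((m + n).factorial : ℝ) / (m.factorial * n.factorial) *
              ((2 : ℝ)⁻¹ ^ m * (2 : ℝ)⁻¹ ^ n)) := by
          rw [e3, Real.rpow_add (by positivity) _ (-(a.re - 1)), Real.rpow_zero]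
          field_simp
      _ ≤ A * B * D * E * (((m : ℝ) + 1) ^
            ((a.re - 1) + ((e - b).re - 1) + (1 - e.re) + (-(a.re - 1))) * ((n : ℝ) + 1) ^ (0 : ℝ) *
            (((m + n : ℕ) : ℝ) + 1) ^ (a.re - 1)) := mul_le_of_le_one_right (by positivity) hchoose
      _ ≤ _ := mul_le_mul_of_nonneg_left (hk m n) (by positivity)
  have h2Y : ‖2 * Y‖ < 1 := by
    rw [norm_mul, Complex.norm_ofNat]; linarith
  have hsum : Summable fun p : ℕ × ℕ =>
      c p.1 * (-1) ^ p.1 * (poch (a + p.1) p.2 / p.2.factorial) * Y ^ (p.1 + p.2) := by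
    refine (summable_mul_pow_of_growth hbound h2Y h2Y).congr fun p => ?_
    simp only [hD2]
    rw [mul_pow, mul_pow, pow_add]
    have e1 : ∀ j : ℕ, (2 : ℂ)⁻¹ ^ j * 2 ^ j = 1 := fun j => by rw [← mul_pow]; norm_num
    linear_combination (c p.1 * (-1) ^ p.1 * (poch (a + p.1) p.2 / p.2.factorial) * Y ^ p.1 *
      Y ^ p.2) * ((2 : ℂ)⁻¹ ^ p.2 * 2 ^ p.2 * e1 p.1 + e1 p.2)
  have hrow : ∀ n : ℕ, HasSum (fun j : ℕ =>
      c n * (-1) ^ n * (poch (a + n) j / j.factorial) * Y ^ (n + j))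
      ((1 - Y) ^ (-a) * (c n * (Y / (Y - 1)) ^ n)) := by
    intro n
    have h := (hasSum_poch_div_factorial_mul_pow (a + n) (hY.trans (by norm_num))).mul_left
      (c n * (-1) ^ n * Y ^ n)
    have e1 : (1 - Y) ^ (-a) * (c n * (Y / (Y - 1)) ^ n) =
        c n * (-1) ^ n * Y ^ n * (1 - Y) ^ (-(a + n)) := by
      rw [neg_add, Complex.cpow_add _ _ h1Y, Complex.cpow_neg _ (n : ℂ), Complex.cpow_natCast,
        ← neg_sub 1 Y, div_neg, ← neg_div, div_pow, neg_pow Y]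
      field_simp
    rw [e1]
    refine h.congr_fun fun j => ?_
    rw [pow_add]; ring
  have hL := hsum.hasSum.prod_fiberwise hrow
  rw [tsum_mul_left.symm]
  refine (Eq.trans (by rw [hc]) hL.tsum_eq).trans ?_
  rw [← Finset.HasAntidiagonal.sigmaAntidiagonalEquivProd.tsum_eq]
  have hsig := (Finset.HasAntidiagonal.sigmaAntidiagonalEquivProd (A := ℕ)).summable_iff.mpr hsum
  refine (Summable.tsum_sigma' (fun N => (hasSum_fintype _).summable) hsig).trans ?_
  refine tsum_congr fun N => ?_
  rw [tsum_fintype, ← pfaff_coeff_sum a b he N, Finset.sum_mul]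
  refine (Finset.sum_coe_sort (Finset.HasAntidiagonal.antidiagonal N)
    (fun p => c p.1 * (-1) ^ p.1 * (poch (a + p.1) p.2 / p.2.factorial) * Y ^ (p.1 + p.2))).trans ?_
  refine Finset.sum_congr rfl fun p hp => ?_
  rw [Finset.HasAntidiagonal.mem_antidiagonal.mp hp, hc]

/-! ### The analytic continuation of `F₃` -/

/-- The continuation of `F₃` to the half plane `re Y < 1 / 2`. -/
noncomputable def pfaffSeries (a a' b b' c X Y : ℂ) : ℂ :=
  (1 - Y) ^ (-a') * ∑' p : ℕ × ℕ, pfaffCoeff a a' b b' c p * X ^ p.1 * (Y / (Y - 1)) ^ p.2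

lemma differentiableOn_pfaffSeries (a a' b b' : ℂ) {c X : ℂ} (hc : 0 < c.re) (hX : ‖X‖ < 1) :
    DifferentiableOn ℂ (pfaffSeries a a' b b' c X) {Y | Y.re < 1 / 2} := by
  obtain ⟨K, k, h⟩ := exists_pfaffCoeff_growth a a' b b' hc
  have hd := differentiableOn_tsum_mul_pow_of_growth h hX
  intro Y hY
  have h1 := one_sub_ne_zero_of_re_lt_half hY
  have h2 : Y - 1 ≠ 0 := by rw [← neg_sub]; exact neg_ne_zero.mpr h1
  have hslit : 1 - Y ∈ Complex.slitPlane := by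
    left; simp only [mem_ofPred_eq] at hY; simp; linarith
  have d1 : DifferentiableAt ℂ (fun Y : ℂ => (1 - Y) ^ (-a')) Y :=
    DifferentiableAt.cpow (by fun_prop) (by fun_prop) hslit
  have d2 : DifferentiableAt ℂ (fun Y : ℂ => Y / (Y - 1)) Y :=
    DifferentiableAt.div (by fun_prop) (by fun_prop) h2
  have d3 := (hd.differentiableAt (x := Y / (Y - 1)) (Metric.isOpen_ball.mem_nhds
    (by rw [mem_ball_zero_iff]; exact norm_div_sub_one_lt hY)))
  exact (d1.mul (d3.comp Y d2)).differentiableWithinAt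

lemma differentiableOn_appellF3Series (a a' b b' : ℂ) {c X : ℂ} (hc : 0 < c.re) (hX : ‖X‖ < 1) :
    DifferentiableOn ℂ (appellF3Series a a' b b' c X) (Metric.ball 0 1) := by
  obtain ⟨K, k, h⟩ := exists_appellF3Coeff_growth a a' b b' hc
  exact differentiableOn_tsum_mul_pow_of_growth h hX

lemma pfaffSeries_eq_appellF3Series_of_norm_lt_half (a a' b b' : ℂ) {c X Y : ℂ} (hc : 0 < c.re)
    (hX : ‖X‖ < 1) (hY : ‖Y‖ < 1 / 2) :
    pfaffSeries a a' b b' c X Y = appellF3Series a a' b b' c X Y := by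
  obtain ⟨K, k, h⟩ := exists_pfaffCoeff_growth a a' b b' hc
  obtain ⟨K', k', h'⟩ := exists_appellF3Coeff_growth a a' b b' hc
  have hZ := norm_div_sub_one_lt ((Complex.re_le_norm Y).trans_lt hY)
  have s1 := summable_mul_pow_of_growth h hX hZ
  have s2 := summable_mul_pow_of_growth h' hX (hY.trans (by norm_num))
  change (1 - Y) ^ (-a') * _ = ∑' p : ℕ × ℕ, appellF3Coeff a a' b b' c p * X ^ p.1 * Y ^ p.2
  rw [s1.tsum_prod, s2.tsum_prod, ← tsum_mul_left]
  refine tsum_congr fun m => ?_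
  have hcm : 0 < (c + m).re := by
    have : (0 : ℝ) ≤ m := Nat.cast_nonneg m
    simp; linarith
  have key := pfaff_transformation a' b' hcm hY
  have l : ∑' n : ℕ, pfaffCoeff a a' b b' c (m, n) * X ^ m * (Y / (Y - 1)) ^ n =
      poch a m * poch b m / (poch c m * m.factorial) * X ^ m *
        ∑' n : ℕ, poch a' n * poch (c + m - b') n / (poch (c + m) n * n.factorial) *
          (Y / (Y - 1)) ^ n := by
    rw [← tsum_mul_left]
    refine tsum_congr fun n => ?_
    simp only [pfaffCoeff]
    rw [poch_add c, show c + m - b' = c - b' + m by ring]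
    simp only [div_eq_mul_inv, mul_inv]; ring
  have r : ∑' n : ℕ, appellF3Coeff a a' b b' c (m, n) * X ^ m * Y ^ n =
      poch a m * poch b m / (poch c m * m.factorial) * X ^ m *
        ∑' n : ℕ, poch a' n * poch b' n / (poch (c + m) n * n.factorial) * Y ^ n := by
    rw [← tsum_mul_left]
    refine tsum_congr fun n => ?_
    simp only [appellF3Coeff]
    rw [poch_add c]
    simp only [div_eq_mul_inv, mul_inv]; ring
  rw [l, r, ← key]; ring

lemma pfaffSeries_eq_appellF3Series (a a' b b' : ℂ) {c X Y : ℂ} (hc : 0 < c.re)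
    (hX : ‖X‖ < 1) (hY : ‖Y‖ < 1) (hY' : Y.re < 1 / 2) :
    pfaffSeries a a' b b' c X Y = appellF3Series a a' b b' c X Y := by
  have hopen : IsOpen (Metric.ball (0 : ℂ) 1 ∩ {Y : ℂ | Y.re < 1 / 2}) :=
    Metric.isOpen_ball.inter (isOpen_lt Complex.continuous_re continuous_const)
  have hconn : IsPreconnected (Metric.ball (0 : ℂ) 1 ∩ {Y : ℂ | Y.re < 1 / 2}) :=
    ((convex_ball (0 : ℂ) 1).inter (convex_halfSpace_re_lt _)).isPreconnected
  have d1 := (differentiableOn_pfaffSeries a a' b b' hc hX).mono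
    (inter_subset_right (s := Metric.ball (0 : ℂ) 1))
  have d2 := (differentiableOn_appellF3Series a a' b b' hc hX).mono
    (inter_subset_left (t := {Y : ℂ | Y.re < 1 / 2}))
  refine (d1.analyticOnNhd hopen).eqOn_of_preconnected_of_eventuallyEq (d2.analyticOnNhd hopen)
    hconn (z₀ := 0) (by simp) ?_ ⟨by rwa [mem_ball_zero_iff], hY'⟩
  filter_upwards [Metric.ball_mem_nhds (0 : ℂ) (show (0 : ℝ) < 1 / 2 by norm_num)] with Z hZ
  exact pfaffSeries_eq_appellF3Series_of_norm_lt_half a a' b b' hc hX (by simpa using hZ)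

open Classical in
lemma isAppellF3Continuation_ite (a a' b b' : ℂ) {c X : ℂ} (hc : 0 < c.re) (hX : ‖X‖ < 1) :
    IsAppellF3Continuation a a' b b' c X fun Y =>
      if ‖Y‖ < 1 then appellF3Series a a' b b' c X Y else pfaffSeries a a' b b' c X Y := by
  refine ⟨fun Y hY => ?_, fun Y hY => if_pos hY⟩
  rcases hY with hY | hY
  · have hmem : Metric.ball (0 : ℂ) 1 ∈ nhds Y :=
      Metric.isOpen_ball.mem_nhds (by rwa [mem_ball_zero_iff])
    refine (((differentiableOn_appellF3Series a a' b b' hc hX).differentiableAt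
      hmem).congr_of_eventuallyEq ?_).differentiableWithinAt
    filter_upwards [hmem] with Z hZ
    exact if_pos (by simpa using hZ)
  · have hopen : IsOpen {Y : ℂ | Y.re < 1 / 2} :=
      isOpen_lt Complex.continuous_re continuous_const
    have hmem : {Y : ℂ | Y.re < 1 / 2} ∈ nhds Y :=
      hopen.mem_nhds (show Y.re < 1 / 2 by linarith)
    refine (((differentiableOn_pfaffSeries a a' b b' hc hX).differentiableAt
      hmem).congr_of_eventuallyEq ?_).differentiableWithinAt
    filter_upwards [hmem] with Z hZ
    split_ifs with h1
    · exact (pfaffSeries_eq_appellF3Series a a' b b' hc hX h1 hZ).symm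
    · rfl

/-- In the left half plane the continued `F₃` is given by the Pfaff transform of its series. -/
theorem appellF3_eq_pfaffSeries (a a' b b' : ℂ) {c X Y : ℂ} (hc : 0 < c.re) (hX : ‖X‖ < 1)
    (hY : Y.re < 0) : appellF3 a a' b b' c X Y = pfaffSeries a a' b b' c X Y := by
  have hG := isAppellF3Continuation_ite a a' b b' hc hX
  have hex : ∃ G : ℂ → ℂ, IsAppellF3Continuation a a' b b' c X G := ⟨_, hG⟩
  rw [appellF3, dif_pos hex, hex.choose_spec.eqOn hG (Or.inr hY)]
  dsimp only
  split_ifs with h1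
  · exact (pfaffSeries_eq_appellF3Series a a' b b' hc hX h1 (by linarith)).symm
  · rfl

/-! ### Beta integrals and term by term integration -/

lemma integrable_tsum_of_summable_integral_norm {α ι : Type*} [Countable ι] [MeasurableSpace α]
    {μ : Measure α} {F : ι → α → ℂ} (hF : ∀ i, Integrable (F i) μ)
    (hs : Summable fun i => ∫ y, ‖F i y‖ ∂μ) : Integrable (fun y => ∑' i, F i y) μ := by
  have hlt : ∫⁻ y, ∑' i, ‖F i y‖ₑ ∂μ < ⊤ := by
    rw [lintegral_tsum fun i => (hF i).1.enorm]
    have e : ∀ i, ∫⁻ y, ‖F i y‖ₑ ∂μ = ENNReal.ofReal (∫ y, ‖F i y‖ ∂μ) := fun i => by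
      rw [ofReal_integral_norm_eq_lintegral_enorm (hF i)]
    simp only [e]
    rw [← ENNReal.ofReal_tsum_of_nonneg (fun i => integral_nonneg fun _ => norm_nonneg _) hs]
    exact ENNReal.ofReal_lt_top
  have hae : ∀ᵐ y ∂μ, Summable fun i => F i y := by
    filter_upwards [ae_lt_top' (AEMeasurable.tsum fun i => (hF i).1.enorm) hlt.ne] with y hy
    refine Summable.of_norm ?_
    have := ENNReal.summable_toReal hy.ne
    simpa using this
  have hmeas : AEStronglyMeasurable (fun y => ∑' i, F i y) μ := by
    refine aestronglyMeasurable_of_tendsto_ae (Filter.atTop : Filter (Finset ι))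
      (f := fun s y => ∑ i ∈ s, F i y)
      (fun s => Finset.aestronglyMeasurable_fun_sum s fun i _ => (hF i).1) ?_
    filter_upwards [hae] with y hy
    exact hy.hasSum
  refine ⟨hmeas, lt_of_le_of_lt (lintegral_mono_ae ?_) hlt⟩
  filter_upwards [hae] with y hy
  exact enorm_tsum_le_tsum_enorm

lemma integrableOn_beta {d c : ℂ} (hd : 0 < d.re) (hc : 0 < c.re) :
    IntegrableOn (fun y : ℝ => (y : ℂ) ^ (d - 1) * (1 - (y : ℂ)) ^ (c - 1)) (Ioo 0 1) := by
  have := Complex.betaIntegral_convergent hd hc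
  rw [intervalIntegrable_iff_integrableOn_Ioo_of_le zero_le_one] at this
  exact this

lemma integral_beta {d c : ℂ} (hd : 0 < d.re) (hc : 0 < c.re) :
    ∫ y in Ioo (0 : ℝ) 1, (y : ℂ) ^ (d - 1) * (1 - (y : ℂ)) ^ (c - 1) =
      Complex.Gamma d * Complex.Gamma c / Complex.Gamma (d + c) := by
  rw [← Complex.betaIntegral_eq_Gamma_mul_div d c hd hc, Complex.betaIntegral,
    intervalIntegral.integral_of_le zero_le_one, integral_Ioc_eq_integral_Ioo]

lemma integral_norm_beta {d c : ℂ} (hd : 0 < d.re) (hc : 0 < c.re) :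
    ((∫ y in Ioo (0 : ℝ) 1, ‖(y : ℂ) ^ (d - 1) * (1 - (y : ℂ)) ^ (c - 1)‖ : ℝ) : ℂ) =
      Complex.Gamma d.re * Complex.Gamma c.re / Complex.Gamma (d.re + c.re) := by
  rw [← integral_beta (by simpa using hd) (by simpa using hc), ← integral_complex_ofReal]
  refine setIntegral_congr_fun measurableSet_Ioo fun y hy => ?_
  have h1 : (0 : ℝ) < 1 - y := by linarith [hy.2]
  rw [norm_mul, Complex.norm_cpow_eq_rpow_re_of_pos hy.1, ← Complex.ofReal_one,
    ← Complex.ofReal_sub, Complex.norm_cpow_eq_rpow_re_of_pos h1, ← Complex.ofReal_sub,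
    ← Complex.ofReal_sub, ← Complex.ofReal_cpow hy.1.le, ← Complex.ofReal_cpow h1.le]
  simp

lemma exists_integral_norm_beta_le {d c : ℂ} (hd : 0 < d.re) (hc : 0 < c.re) :
    ∃ C : ℝ, 0 < C ∧ ∀ N : ℕ,
      ∫ y in Ioo (0 : ℝ) 1, ‖(y : ℂ) ^ (d - 1) * (1 - (y : ℂ)) ^ (c + N - 1)‖ ≤
        C * ((N : ℝ) + 1) ^ (-d.re) := by
  have hcr : 0 < ((c.re : ℝ) : ℂ).re := by simpa using hc
  have hdcr : 0 < ((d.re : ℂ) + c.re).re := by simp; linarith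
  obtain ⟨A, hA, hA'⟩ := exists_norm_poch_le (c.re : ℂ)
  obtain ⟨B, hB, hB'⟩ := exists_inv_norm_poch_le hdcr
  refine ⟨‖Complex.Gamma d.re * Complex.Gamma c.re / Complex.Gamma (d.re + c.re)‖ * A * B, ?_,
    fun N => ?_⟩
  · have g1 := Complex.Gamma_ne_zero_of_re_pos hcr
    have g2 := Complex.Gamma_ne_zero_of_re_pos hdcr
    have g3 := Complex.Gamma_ne_zero_of_re_pos (s := (d.re : ℂ)) (by simpa using hd)
    have : 0 < ‖Complex.Gamma d.re * Complex.Gamma c.re / Complex.Gamma (d.re + c.re)‖ :=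
      norm_pos_iff.mpr (div_ne_zero (mul_ne_zero g3 g1) g2)
    positivity
  · have hcN : 0 < (c + N).re := by
      have : (0 : ℝ) ≤ N := Nat.cast_nonneg N
      simp; linarith
    have h := congrArg norm (integral_norm_beta hd hcN)
    rw [Complex.norm_of_nonneg (integral_nonneg fun _ => norm_nonneg _)] at h
    rw [h]
    have e1 : (((c + N).re : ℝ) : ℂ) = c.re + N := by simp
    rw [e1, ← add_assoc, Gamma_add_natCast (ne_neg_natCast_of_re_pos hcr),
      Gamma_add_natCast (ne_neg_natCast_of_re_pos hdcr)]
    have e2 : Complex.Gamma d.re * (poch c.re N * Complex.Gamma c.re) /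
        (poch (d.re + c.re) N * Complex.Gamma (d.re + c.re)) =
        (Complex.Gamma d.re * Complex.Gamma c.re / Complex.Gamma (d.re + c.re)) *
          poch c.re N * (poch (d.re + c.re) N)⁻¹ := by
      simp only [div_eq_mul_inv, mul_inv]; ring
    rw [e2, norm_mul, norm_mul, norm_inv]
    have hpow : ((N : ℝ) + 1) ^ (-d.re) = ((N : ℝ) + 1) ^ (((c.re : ℝ) : ℂ).re - 1) *
        ((N : ℝ) + 1) ^ (1 - ((d.re : ℂ) + c.re).re) := by
      rw [← Real.rpow_add (by positivity)]
      congr 1; simp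
    calc _ ≤ ‖Complex.Gamma d.re * Complex.Gamma c.re / Complex.Gamma (d.re + c.re)‖ *
          (A * (N.factorial * ((N : ℝ) + 1) ^ (((c.re : ℝ) : ℂ).re - 1))) *
          (B * (((N : ℝ) + 1) ^ (1 - ((d.re : ℂ) + c.re).re) / N.factorial)) := by
          gcongr
          exacts [hA' N, hB' N]
      _ = _ := by rw [hpow]; field_simp

/-- The convergence criterion that decides when the kernel may be integrated term by term. -/
lemma summable_rpow_triple {p q r : ℝ} (hp : p < r) (hq : q < r) (hpq : p + q < r) :
    Summable fun x : ℕ × ℕ => ((x.1 : ℝ) + 1) ^ (p - 1) * ((x.2 : ℝ) + 1) ^ (q - 1) *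
      (((x.1 + x.2 : ℕ) : ℝ) + 1) ^ (-r) := by
  -- split the exponent `r` between the two indices
  obtain ⟨r₁, r₂, h₁, h₂, h⟩ : ∃ r₁ r₂ : ℝ, p < r₁ ∧ q < r₂ ∧ ∀ m n : ℕ,
      (((m + n : ℕ) : ℝ) + 1) ^ (-r) ≤ ((m : ℝ) + 1) ^ (-r₁) * ((n : ℝ) + 1) ^ (-r₂) := by
    rcases le_or_gt r 0 with hr | hr
    · refine ⟨r, r, hp, hq, fun m n => ?_⟩
      have hm : (0 : ℝ) ≤ m := Nat.cast_nonneg m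
      have hn : (0 : ℝ) ≤ n := Nat.cast_nonneg n
      rw [← Real.mul_rpow (by positivity) (by positivity)]
      exact Real.rpow_le_rpow (by positivity) (by push_cast; nlinarith) (by linarith)
    · set ε := (r - max p 0 - max q 0) / 2 with hε
      have hε0 : 0 < ε := by
        rw [hε]
        rcases max_choice p 0 with h | h <;> rcases max_choice q 0 with h' | h' <;>
          rw [h, h'] <;> linarith
      refine ⟨max p 0 + ε, max q 0 + ε, by linarith [le_max_left p 0],
        by linarith [le_max_left q 0], fun m n => ?_⟩
      have hm : (0 : ℝ) ≤ m := Nat.cast_nonneg m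
      have hn : (0 : ℝ) ≤ n := Nat.cast_nonneg n
      have e : -r = -(max p 0 + ε) + -(max q 0 + ε) := by rw [hε]; ring
      rw [e, Real.rpow_add (by positivity)]
      refine mul_le_mul ?_ ?_ (by positivity) (by positivity)
      · exact Real.rpow_le_rpow_of_nonpos (by positivity) (by push_cast; linarith)
          (by linarith [le_max_right p 0])
      · exact Real.rpow_le_rpow_of_nonpos (by positivity) (by push_cast; linarith)
          (by linarith [le_max_right q 0])
  have s1 := summable_natCast_add_one_rpow (s := p - 1 - r₁) (by linarith)
  have s2 := summable_natCast_add_one_rpow (s := q - 1 - r₂) (by linarith)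
  refine Summable.of_nonneg_of_le (fun x => by positivity) (fun x => ?_)
    (s1.mul_of_nonneg s2 (fun _ => by positivity) (fun _ => by positivity))
  calc _ ≤ ((x.1 : ℝ) + 1) ^ (p - 1) * ((x.2 : ℝ) + 1) ^ (q - 1) *
        (((x.1 : ℝ) + 1) ^ (-r₁) * ((x.2 : ℝ) + 1) ^ (-r₂)) := by gcongr; exact h _ _
    _ = _ := by
      rw [sub_eq_add_neg (p - 1), sub_eq_add_neg (q - 1), Real.rpow_add (by positivity),
        Real.rpow_add (by positivity)]
      ring

/-! ### The Mellin transform of the kernel -/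

/-- The series `Φ(u)` with `F₃(a, a', b, b'; c; u, u / (u - 1)) = (1 - u) ^ a' Φ(u)`. -/
noncomputable def kernelSeries (a a' b b' c u : ℂ) : ℂ :=
  ∑' p : ℕ × ℕ, pfaffCoeff a a' b b' c p * u ^ (p.1 + p.2)

/-- The sum of the Beta integrals of the terms of the kernel, by Gauss' theorem in the second and
then in the first index. -/
lemma tsum_pfaffCoeff_mul_Gamma {a a' b b' c d : ℂ} (hc : 0 < c.re)
    (h₁ : 0 < (d + b' - a').re) (h₂ : 0 < (d + c - a - b - a').re)
    (hs : Summable fun p : ℕ × ℕ => pfaffCoeff a a' b b' c p *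
      (Complex.Gamma d * Complex.Gamma (c + (p.1 + p.2 : ℕ)) /
        Complex.Gamma (d + (c + (p.1 + p.2 : ℕ))))) :
    ∑' p : ℕ × ℕ, pfaffCoeff a a' b b' c p *
      (Complex.Gamma d * Complex.Gamma (c + (p.1 + p.2 : ℕ)) /
        Complex.Gamma (d + (c + (p.1 + p.2 : ℕ)))) =
    Complex.Gamma c * (Complex.Gamma d * Complex.Gamma (d + b' - a') *
      Complex.Gamma (d + c - a - b - a') / (Complex.Gamma (d + b') *
        Complex.Gamma (d + c - a' - a) * Complex.Gamma (d + c - a' - b))) := by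
  have hterm : ∀ m n : ℕ, pfaffCoeff a a' b b' c (m, n) *
      (Complex.Gamma d * Complex.Gamma (c + (m + n : ℕ)) /
        Complex.Gamma (d + (c + (m + n : ℕ)))) =
      Complex.Gamma c * Complex.Gamma d * (poch a m * poch b m / m.factorial) *
        (poch a' n * poch (c - b' + m) n * (Complex.Gamma (d + c + m + n))⁻¹ / n.factorial) := by
    intro m n
    have hp := poch_ne_zero (ne_neg_natCast_of_re_pos hc) (m + n)
    rw [Gamma_add_natCast (ne_neg_natCast_of_re_pos hc), pfaffCoeff]
    have e : d + (c + ((m + n : ℕ) : ℂ)) = d + c + m + n := by push_cast; ring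
    rw [e]
    simp only
    rw [div_eq_mul_inv _ (Complex.Gamma (d + c + m + n))]
    field_simp
  have hinner : ∀ m : ℕ, HasSum (fun n : ℕ => pfaffCoeff a a' b b' c (m, n) *
      (Complex.Gamma d * Complex.Gamma (c + (m + n : ℕ)) /
        Complex.Gamma (d + (c + (m + n : ℕ)))))
      (Complex.Gamma c * Complex.Gamma d * (Complex.Gamma (d + b' - a') / Complex.Gamma (d + b')) *
        (poch a m * poch b m * (Complex.Gamma (d + c - a' + m))⁻¹ / m.factorial)) := by
    intro m
    have e1 : d + c + m - a' - (c - b' + m) = d + b' - a' := by ring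
    have g := (hasSum_gauss (a := a') (b := c - b' + m) (c := d + c + m) (by rwa [e1])).mul_left
      (Complex.Gamma c * Complex.Gamma d * (poch a m * poch b m / m.factorial))
    simp only [hterm]
    rw [e1, show d + c + m - a' = d + c - a' + m by ring,
      show d + c + m - (c - b' + m) = d + b' by ring] at g
    refine cast (congrArg (fun v => HasSum _ v) ?_) g
    simp only [div_eq_mul_inv, mul_inv]; ring
  have e2 : d + c - a' - a - b = d + c - a - b - a' := by ring
  have houter := (hasSum_gauss (a := a) (b := b) (c := d + c - a') (by rwa [e2])).mul_left
    (Complex.Gamma c * Complex.Gamma d * (Complex.Gamma (d + b' - a') / Complex.Gamma (d + b')))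
  have := (hs.hasSum.prod_fiberwise hinner).unique houter
  rw [this, e2]
  simp only [div_eq_mul_inv, mul_inv]; ring

/-- The Mellin transform of the kernel `(1 - y) ^ (c - 1) Φ(1 - y)` on `(0, 1)`, in the range where
the double series may be integrated term by term; the sums are then evaluated by applying Gauss's
theorem first in the second and then in the first index. -/
lemma mellin_kernelSeries_of_absolute {a a' b b' c d : ℂ} (hc : 0 < c.re) (hd : 0 < d.re)
    (h₁ : 0 < (d + b' - a').re) (h₂ : 0 < (d + c - a - b - a').re) (h₃ : 0 < (d + c - a - b).re) :
    IntegrableOn (fun y : ℝ => (y : ℂ) ^ (d - 1) *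
      ((1 - (y : ℂ)) ^ (c - 1) * kernelSeries a a' b b' c (1 - y))) (Ioo 0 1) ∧
    ∫ y in Ioo (0 : ℝ) 1, (y : ℂ) ^ (d - 1) *
      ((1 - (y : ℂ)) ^ (c - 1) * kernelSeries a a' b b' c (1 - y)) =
    Complex.Gamma c * (Complex.Gamma d * Complex.Gamma (d + b' - a') *
      Complex.Gamma (d + c - a - b - a') / (Complex.Gamma (d + b') *
        Complex.Gamma (d + c - a' - a) * Complex.Gamma (d + c - a' - b))) := by
  have hcN : ∀ N : ℕ, 0 < (c + N).re := fun N => by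
    have : (0 : ℝ) ≤ N := Nat.cast_nonneg N
    simp; linarith
  set F : ℕ × ℕ → ℝ → ℂ := fun p y => pfaffCoeff a a' b b' c p *
    ((y : ℂ) ^ (d - 1) * (1 - (y : ℂ)) ^ (c + (p.1 + p.2 : ℕ) - 1)) with hF
  have hFint : ∀ p, Integrable (F p) (volume.restrict (Ioo 0 1)) := fun p =>
    (integrableOn_beta hd (hcN _)).const_mul _
  obtain ⟨A, hA, hA'⟩ := exists_norm_pfaffCoeff_le a a' b b' hc
  obtain ⟨B, hB, hB'⟩ := exists_integral_norm_beta_le hd hc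
  have hFsum : Summable fun p => ∫ y in Ioo (0 : ℝ) 1, ‖F p y‖ := by
    have hs := summable_rpow_triple (p := (a + b - c + b').re) (q := a'.re) (r := (b' + d).re)
      (by simp at *; linarith) (by simp at *; linarith) (by simp at *; linarith)
    refine Summable.of_nonneg_of_le (fun p => integral_nonneg fun _ => norm_nonneg _) (fun p => ?_)
      (hs.mul_left (A * B))
    simp only [hF, norm_mul (pfaffCoeff _ _ _ _ _ _)]
    rw [integral_const_mul]
    have e : (((p.1 + p.2 : ℕ) : ℝ) + 1) ^ (-(b' + d).re) =
        (((p.1 + p.2 : ℕ) : ℝ) + 1) ^ (-b'.re) * (((p.1 + p.2 : ℕ) : ℝ) + 1) ^ (-d.re) := by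
      rw [← Real.rpow_add (by positivity)]
      congr 1; simp; ring
    calc _ ≤ (A * (((p.1 : ℝ) + 1) ^ ((a + b - c + b').re - 1) * ((p.2 : ℝ) + 1) ^ (a'.re - 1) *
          (((p.1 + p.2 : ℕ) : ℝ) + 1) ^ (-b'.re))) *
          (B * (((p.1 + p.2 : ℕ) : ℝ) + 1) ^ (-d.re)) := by
          refine mul_le_mul (hA' p) (hB' _) (integral_nonneg fun _ => norm_nonneg _) (by positivity)
      _ = _ := by rw [e]; ring
  have hEq : EqOn (fun y => ∑' p, F p y) (fun y : ℝ => (y : ℂ) ^ (d - 1) *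
      ((1 - (y : ℂ)) ^ (c - 1) * kernelSeries a a' b b' c (1 - y))) (Ioo 0 1) := by
    intro y hy
    have h0 : (1 - (y : ℂ)) ≠ 0 := by
      have : (1 - y : ℝ) ≠ 0 := by linarith [hy.2]
      exact_mod_cast this
    simp only [hF]
    rw [kernelSeries, ← mul_assoc, ← tsum_mul_left]
    refine tsum_congr fun p => ?_
    rw [add_sub_right_comm, Complex.cpow_add _ _ h0, Complex.cpow_natCast]
    ring
  have hint := integrable_tsum_of_summable_integral_norm hFint hFsum
  have hsum := hasSum_integral_of_summable_integral_norm hFint hFsum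
  refine ⟨IntegrableOn.congr_fun hint hEq measurableSet_Ioo, ?_⟩
  rw [← setIntegral_congr_fun measurableSet_Ioo hEq, ← hsum.tsum_eq]
  have hI : ∀ p : ℕ × ℕ, ∫ y in Ioo (0 : ℝ) 1, F p y = pfaffCoeff a a' b b' c p *
      (Complex.Gamma d * Complex.Gamma (c + (p.1 + p.2 : ℕ)) /
        Complex.Gamma (d + (c + (p.1 + p.2 : ℕ)))) := fun p => by
    simp only [hF]
    rw [integral_const_mul, integral_beta hd (hcN _)]
  have hsm := hsum.summable
  simp only [hI] at hsm ⊢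
  exact tsum_pfaffCoeff_mul_Gamma hc h₁ h₂ hsm

/-! ### Symmetry of the kernel -/

/-- An integrable function on `(0, 1)` all of whose moments vanish is zero almost everywhere. -/
lemma ae_eq_zero_of_moments_eq_zero {g : ℝ → ℂ} (hg : IntegrableOn g (Ioo 0 1))
    (h : ∀ n : ℕ, ∫ y in Ioo (0 : ℝ) 1, (y : ℂ) ^ n * g y = 0) :
    ∀ᵐ y ∂(volume.restrict (Ioo (0 : ℝ) 1)), g y = 0 := by
  have hmul : ∀ φ : ℝ → ℝ, Continuous φ →
      IntegrableOn (fun y => (φ y : ℂ) * g y) (Ioo 0 1) := by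
    intro φ hφ
    obtain ⟨B, hB⟩ := isCompact_Icc.exists_bound_of_continuousOn (s := Icc (0 : ℝ) 1)
      hφ.continuousOn
    refine Integrable.bdd_mul (c := B) hg
      (Complex.continuous_ofReal.comp hφ).aestronglyMeasurable ?_
    filter_upwards [ae_restrict_mem measurableSet_Ioo] with y hy
    rw [Complex.norm_real]
    exact hB y (Ioo_subset_Icc_self hy)
  have hpoly : ∀ p : Polynomial ℝ, ∫ y in Ioo (0 : ℝ) 1, ((p.eval y : ℝ) : ℂ) * g y = 0 := by
    intro p
    have e : ∀ y : ℝ, ((p.eval y : ℝ) : ℂ) * g y =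
        ∑ i ∈ Finset.range (p.natDegree + 1), (p.coeff i : ℂ) * ((y : ℂ) ^ i * g y) := by
      intro y
      rw [Polynomial.eval_eq_sum_range]
      push_cast
      rw [Finset.sum_mul]
      exact Finset.sum_congr rfl fun i _ => by ring
    simp only [e]
    rw [integral_finsetSum]
    · refine Finset.sum_eq_zero fun i _ => ?_
      rw [integral_const_mul, h, mul_zero]
    · intro i _
      refine Integrable.const_mul ?_ _
      have hi := hmul (fun y => y ^ i) (by fun_prop)
      simp only [Complex.ofReal_pow] at hi
      exact hi
  refine ae_eq_zero_of_integral_contDiff_smul_eq_zero hg.locallyIntegrable fun φ hφ _ => ?_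
  simp only [Complex.real_smul]
  set I := ∫ y in Ioo (0 : ℝ) 1, ‖g y‖ with hI
  have hI0 : 0 ≤ I := integral_nonneg fun _ => norm_nonneg _
  by_contra hne
  have hpos : 0 < ‖∫ y in Ioo (0 : ℝ) 1, (φ y : ℂ) * g y‖ := norm_pos_iff.mpr hne
  set ε := ‖∫ y in Ioo (0 : ℝ) 1, (φ y : ℂ) * g y‖ / (I + 1) with hε
  have hε0 : 0 < ε := by positivity
  obtain ⟨p, hp⟩ := exists_polynomial_near_of_continuousOn 0 1 φ hφ.continuous.continuousOn ε hε0
  have hp1 := hmul (fun y => p.eval y) p.continuous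
  have e1 : ∫ y in Ioo (0 : ℝ) 1, (φ y : ℂ) * g y =
      ∫ y in Ioo (0 : ℝ) 1, ((φ y : ℂ) * g y - ((p.eval y : ℝ) : ℂ) * g y) := by
    rw [integral_sub (hmul φ hφ.continuous) hp1, hpoly, sub_zero]
  have hle : ‖∫ y in Ioo (0 : ℝ) 1, (φ y : ℂ) * g y‖ ≤ ε * I := by
    rw [e1, hI, ← integral_const_mul]
    refine norm_integral_le_of_norm_le (hg.norm.const_mul ε) ?_
    filter_upwards [ae_restrict_mem measurableSet_Ioo] with y hy
    rw [← sub_mul, norm_mul, ← Complex.ofReal_sub, Complex.norm_real, norm_sub_rev]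
    exact mul_le_mul_of_nonneg_right (hp y (Ioo_subset_Icc_self hy)).le (norm_nonneg _)
  have : ε * (I + 1) = ‖∫ y in Ioo (0 : ℝ) 1, (φ y : ℂ) * g y‖ := by
    rw [hε]; field_simp
  nlinarith

/-- The kernel in the parameters in which its Mellin transform is
`∏ Γ(z + sᵢ) / ∏ Γ(z + tᵢ)`. The transform is symmetric in the `sᵢ` and in the `tᵢ`; the series
defining the kernel is not. -/
noncomputable def mellinKernel (s₁ s₂ s₃ t₁ t₂ t₃ : ℂ) (y : ℝ) : ℂ :=
  (y : ℂ) ^ s₁ * ((1 - (y : ℂ)) ^ (t₁ + t₂ + t₃ - s₁ - s₂ - s₃ - 1) *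
    kernelSeries (t₃ - s₃) (t₂ - s₂) (t₁ - s₃) (t₂ - s₁) (t₁ + t₂ + t₃ - s₁ - s₂ - s₃) (1 - y))

lemma mellin_mellinKernel_of_absolute {s₁ s₂ s₃ t₁ t₂ t₃ z : ℂ}
    (hc : 0 < (t₁ + t₂ + t₃ - s₁ - s₂ - s₃).re) (h₁ : 0 < (z + s₁).re) (h₂ : 0 < (z + s₂).re)
    (h₃ : 0 < (z + s₃).re) (h₄ : 0 < (z + t₂ - s₂ + s₃).re) :
    IntegrableOn (fun y : ℝ => (y : ℂ) ^ (z - 1) * mellinKernel s₁ s₂ s₃ t₁ t₂ t₃ y) (Ioo 0 1) ∧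
    ∫ y in Ioo (0 : ℝ) 1, (y : ℂ) ^ (z - 1) * mellinKernel s₁ s₂ s₃ t₁ t₂ t₃ y =
    Complex.Gamma (t₁ + t₂ + t₃ - s₁ - s₂ - s₃) *
      (Complex.Gamma (z + s₁) * Complex.Gamma (z + s₂) * Complex.Gamma (z + s₃) /
        (Complex.Gamma (z + t₁) * Complex.Gamma (z + t₂) * Complex.Gamma (z + t₃))) := by
  have e1 : z + s₁ + (t₂ - s₁) - (t₂ - s₂) = z + s₂ := by ring
  have e2 : z + s₁ + (t₁ + t₂ + t₃ - s₁ - s₂ - s₃) - (t₃ - s₃) - (t₁ - s₃) - (t₂ - s₂) =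
    z + s₃ := by ring
  have e3 : z + s₁ + (t₁ + t₂ + t₃ - s₁ - s₂ - s₃) - (t₃ - s₃) - (t₁ - s₃) =
    z + t₂ - s₂ + s₃ := by ring
  have key := mellin_kernelSeries_of_absolute (a := t₃ - s₃) (a' := t₂ - s₂) (b := t₁ - s₃)
    (b' := t₂ - s₁) hc h₁ (by rwa [e1]) (by rwa [e2]) (by rwa [e3])
  rw [e1, e2, show z + s₁ + (t₂ - s₁) = z + t₂ by ring,
    show z + s₁ + (t₁ + t₂ + t₃ - s₁ - s₂ - s₃) - (t₂ - s₂) - (t₃ - s₃) = z + t₁ by ring,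
    show z + s₁ + (t₁ + t₂ + t₃ - s₁ - s₂ - s₃) - (t₂ - s₂) - (t₁ - s₃) = z + t₃ by ring] at key
  have hEq : EqOn (fun y : ℝ => (y : ℂ) ^ (z + s₁ - 1) *
      ((1 - (y : ℂ)) ^ (t₁ + t₂ + t₃ - s₁ - s₂ - s₃ - 1) * kernelSeries (t₃ - s₃) (t₂ - s₂)
        (t₁ - s₃) (t₂ - s₁) (t₁ + t₂ + t₃ - s₁ - s₂ - s₃) (1 - y)))
      (fun y : ℝ => (y : ℂ) ^ (z - 1) * mellinKernel s₁ s₂ s₃ t₁ t₂ t₃ y) (Ioo 0 1) := by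
    intro y hy
    have hy0 : (y : ℂ) ≠ 0 := by exact_mod_cast hy.1.ne'
    simp only [mellinKernel]
    rw [add_sub_right_comm, Complex.cpow_add _ _ hy0]
    ring
  refine ⟨IntegrableOn.congr_fun key.1 hEq measurableSet_Ioo, ?_⟩
  rw [← setIntegral_congr_fun measurableSet_Ioo hEq, key.2]
  congr 2; ring

/-- Two kernels with the same Mellin transform agree: far to the right both transforms are given by
the same Gamma quotient, and the moments determine the kernel. -/
lemma mellinKernel_ae_eq {s₁ s₂ s₃ t₁ t₂ t₃ s₁' s₂' s₃' t₁' t₂' t₃' : ℂ}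
    (hc : 0 < (t₁ + t₂ + t₃ - s₁ - s₂ - s₃).re)
    (hcc : t₁' + t₂' + t₃' - s₁' - s₂' - s₃' = t₁ + t₂ + t₃ - s₁ - s₂ - s₃)
    (hR : ∀ z : ℂ, Complex.Gamma (z + s₁) * Complex.Gamma (z + s₂) * Complex.Gamma (z + s₃) /
        (Complex.Gamma (z + t₁) * Complex.Gamma (z + t₂) * Complex.Gamma (z + t₃)) =
      Complex.Gamma (z + s₁') * Complex.Gamma (z + s₂') * Complex.Gamma (z + s₃') /
        (Complex.Gamma (z + t₁') * Complex.Gamma (z + t₂') * Complex.Gamma (z + t₃'))) :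
    ∀ᵐ y ∂(volume.restrict (Ioo (0 : ℝ) 1)),
      mellinKernel s₁ s₂ s₃ t₁ t₂ t₃ y = mellinKernel s₁' s₂' s₃' t₁' t₂' t₃' y := by
  -- from `D` on, both transforms are in the range of term by term integration
  obtain ⟨D, hD⟩ : ∃ D : ℕ, ∀ w ∈ ({s₁, s₂, s₃, t₂ - s₂ + s₃, s₁', s₂', s₃',
      t₂' - s₂' + s₃'} : Finset ℂ), -w.re < D := by
    obtain ⟨D, hD⟩ := exists_nat_gt (∑ w ∈ ({s₁, s₂, s₃, t₂ - s₂ + s₃, s₁', s₂', s₃',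
      t₂' - s₂' + s₃'} : Finset ℂ), |w.re|)
    refine ⟨D, fun w hw => lt_of_le_of_lt ?_ hD⟩
    exact (neg_le_abs _).trans (Finset.single_le_sum (f := fun w : ℂ => |w.re|)
      (fun _ _ => abs_nonneg _) hw)
  have hpos : ∀ n : ℕ, ∀ w ∈ ({s₁, s₂, s₃, t₂ - s₂ + s₃, s₁', s₂', s₃',
      t₂' - s₂' + s₃'} : Finset ℂ), 0 < ((D + n : ℕ) + w : ℂ).re := by
    intro n w hw
    have := hD w hw
    have hn : (0 : ℝ) ≤ n := Nat.cast_nonneg n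
    simp; linarith
  have k1 := fun n : ℕ => mellin_mellinKernel_of_absolute (z := (D + n : ℕ)) hc
    (hpos n s₁ (by simp)) (hpos n s₂ (by simp)) (hpos n s₃ (by simp))
    (by rw [show ((D + n : ℕ) : ℂ) + t₂ - s₂ + s₃ = (D + n : ℕ) + (t₂ - s₂ + s₃) by ring]
        exact hpos n _ (by simp))
  have k2 := fun n : ℕ => mellin_mellinKernel_of_absolute (z := (D + n : ℕ))
    (by rw [hcc]; exact hc)
    (hpos n s₁' (by simp)) (hpos n s₂' (by simp)) (hpos n s₃' (by simp))
    (by rw [show ((D + n : ℕ) : ℂ) + t₂' - s₂' + s₃' = (D + n : ℕ) + (t₂' - s₂' + s₃') by ring]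
        exact hpos n _ (by simp))
  have hz := ae_eq_zero_of_moments_eq_zero ((k1 0).1.sub (k2 0).1) fun n => ?_
  · filter_upwards [hz, ae_restrict_mem measurableSet_Ioo] with y hy hy01
    simp only [Pi.sub_apply] at hy
    rw [← mul_sub] at hy
    have hy0 : (y : ℂ) ≠ 0 := by exact_mod_cast hy01.1.ne'
    rcases mul_eq_zero.mp hy with h | h
    · exact absurd h (by simp [Complex.cpow_eq_zero_iff, hy0])
    · exact sub_eq_zero.mp h
  · have e : EqOn (fun y : ℝ => (y : ℂ) ^ n * ((fun y : ℝ => (y : ℂ) ^ (((D + 0 : ℕ) : ℂ) - 1) *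
          mellinKernel s₁ s₂ s₃ t₁ t₂ t₃ y) - fun y : ℝ => (y : ℂ) ^ (((D + 0 : ℕ) : ℂ) - 1) *
          mellinKernel s₁' s₂' s₃' t₁' t₂' t₃' y) y)
        (fun y : ℝ => (y : ℂ) ^ (((D + n : ℕ) : ℂ) - 1) * mellinKernel s₁ s₂ s₃ t₁ t₂ t₃ y -
          (y : ℂ) ^ (((D + n : ℕ) : ℂ) - 1) * mellinKernel s₁' s₂' s₃' t₁' t₂' t₃' y)
        (Ioo 0 1) := by
      intro y hy
      have hy0 : (y : ℂ) ≠ 0 := by exact_mod_cast hy.1.ne'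
      have e1 : (y : ℂ) ^ (((D + n : ℕ) : ℂ) - 1) =
          (y : ℂ) ^ n * (y : ℂ) ^ (((D + 0 : ℕ) : ℂ) - 1) := by
        rw [← Complex.cpow_natCast, ← Complex.cpow_add _ _ hy0]
        congr 1; push_cast; ring
      simp only [Pi.sub_apply]
      rw [e1]; ring
    rw [setIntegral_congr_fun measurableSet_Ioo e, integral_sub (k1 n).1 (k2 n).1, (k1 n).2,
      (k2 n).2, hcc, hR, sub_self]

/-- The Mellin transform of the kernel in its full range of absolute convergence. As
`∑ re (tᵢ - sᵢ) > 0`, some `re tᵢ` exceeds `re sᵢ`; by symmetry of the kernel one may take `i = 2`,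
and then term by term integration is allowed. -/
theorem mellin_mellinKernel {s₁ s₂ s₃ t₁ t₂ t₃ z : ℂ}
    (hc : 0 < (t₁ + t₂ + t₃ - s₁ - s₂ - s₃).re) (h₁ : 0 < (z + s₁).re) (h₂ : 0 < (z + s₂).re)
    (h₃ : 0 < (z + s₃).re) :
    IntegrableOn (fun y : ℝ => (y : ℂ) ^ (z - 1) * mellinKernel s₁ s₂ s₃ t₁ t₂ t₃ y) (Ioo 0 1) ∧
    ∫ y in Ioo (0 : ℝ) 1, (y : ℂ) ^ (z - 1) * mellinKernel s₁ s₂ s₃ t₁ t₂ t₃ y =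
    Complex.Gamma (t₁ + t₂ + t₃ - s₁ - s₂ - s₃) *
      (Complex.Gamma (z + s₁) * Complex.Gamma (z + s₂) * Complex.Gamma (z + s₃) /
        (Complex.Gamma (z + t₁) * Complex.Gamma (z + t₂) * Complex.Gamma (z + t₃))) := by
  have transfer : ∀ s₁' s₂' s₃' t₁' t₂' t₃' : ℂ,
      t₁' + t₂' + t₃' - s₁' - s₂' - s₃' = t₁ + t₂ + t₃ - s₁ - s₂ - s₃ →
      (∀ z : ℂ, Complex.Gamma (z + s₁) * Complex.Gamma (z + s₂) * Complex.Gamma (z + s₃) /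
        (Complex.Gamma (z + t₁) * Complex.Gamma (z + t₂) * Complex.Gamma (z + t₃)) =
      Complex.Gamma (z + s₁') * Complex.Gamma (z + s₂') * Complex.Gamma (z + s₃') /
        (Complex.Gamma (z + t₁') * Complex.Gamma (z + t₂') * Complex.Gamma (z + t₃'))) →
      0 < (z + s₁').re → 0 < (z + s₂').re → 0 < (z + s₃').re → s₂'.re < t₂'.re →
      IntegrableOn (fun y : ℝ => (y : ℂ) ^ (z - 1) * mellinKernel s₁ s₂ s₃ t₁ t₂ t₃ y) (Ioo 0 1) ∧
      ∫ y in Ioo (0 : ℝ) 1, (y : ℂ) ^ (z - 1) * mellinKernel s₁ s₂ s₃ t₁ t₂ t₃ y =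
      Complex.Gamma (t₁ + t₂ + t₃ - s₁ - s₂ - s₃) *
        (Complex.Gamma (z + s₁) * Complex.Gamma (z + s₂) * Complex.Gamma (z + s₃) /
          (Complex.Gamma (z + t₁) * Complex.Gamma (z + t₂) * Complex.Gamma (z + t₃))) := by
    intro s₁' s₂' s₃' t₁' t₂' t₃' hcc hR h₁' h₂' h₃' hlt
    have key := mellin_mellinKernel_of_absolute (z := z) (by rw [hcc]; exact hc) h₁' h₂' h₃'
      (by simp at h₃' ⊢; linarith : 0 < (z + t₂' - s₂' + s₃').re)
    have hae : (fun y : ℝ => (y : ℂ) ^ (z - 1) * mellinKernel s₁ s₂ s₃ t₁ t₂ t₃ y)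
        =ᵐ[volume.restrict (Ioo 0 1)]
        fun y : ℝ => (y : ℂ) ^ (z - 1) * mellinKernel s₁' s₂' s₃' t₁' t₂' t₃' y := by
      filter_upwards [mellinKernel_ae_eq hc hcc hR] with y hy
      rw [hy]
    refine ⟨key.1.congr hae.symm, ?_⟩
    rw [integral_congr_ae hae, key.2, hcc, hR]
  have hor : s₂.re < t₂.re ∨ s₁.re < t₁.re ∨ s₃.re < t₃.re := by
    by_contra! hcon
    simp at hc
    linarith [hcon.1, hcon.2.1, hcon.2.2]
  rcases hor with h | h | h
  · exact transfer s₁ s₂ s₃ t₁ t₂ t₃ rfl (fun _ => rfl) h₁ h₂ h₃ h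
  · refine transfer s₂ s₁ s₃ t₂ t₁ t₃ (by ring) (fun w => ?_) h₂ h₁ h₃ h
    congr 1 <;> ring
  · refine transfer s₁ s₃ s₂ t₁ t₃ t₂ (by ring) (fun w => ?_) h₁ h₃ h₂ h
    congr 1 <;> ring

/-! ### Reduction of the Marichev-Saigo-Maeda integral to the kernel -/

/-- The kernel of the right-sided Marichev-Saigo-Maeda operator as a function of `y = x / t`. -/
noncomputable def msmKernel (α α' β β' γ : ℂ) : ℝ → ℂ :=
  mellinKernel (α + α' - γ) (α + β' - γ) (-β) 0 (α + α' + β' - γ) (α - β)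

lemma msmKernel_apply (α α' β β' γ : ℂ) (y : ℝ) :
    msmKernel α α' β β' γ y = (y : ℂ) ^ (α + α' - γ) *
      ((1 - (y : ℂ)) ^ (γ - 1) * kernelSeries α α' β β' γ (1 - y)) := by
  rw [msmKernel, mellinKernel]
  congr <;> ring

/-- At `t = x / y` both arguments of the Pfaff transform of `F₃` equal `1 - y`. -/
lemma appellF3_div_eq (α α' β β' : ℂ) {γ : ℂ} (hγ : 0 < γ.re) {x y : ℝ} (hx : 0 < x)
    (hy : y ∈ Ioo (0 : ℝ) 1) :
    appellF3 α α' β β' γ (1 - (x : ℂ) / ((x / y : ℝ) : ℂ)) (1 - ((x / y : ℝ) : ℂ) / (x : ℂ)) =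
      (y : ℂ) ^ α' * kernelSeries α α' β β' γ (1 - y) := by
  have hx0 : (x : ℂ) ≠ 0 := by exact_mod_cast hx.ne'
  have hy0 : (y : ℂ) ≠ 0 := by exact_mod_cast hy.1.ne'
  have e1 : 1 - (x : ℂ) / ((x / y : ℝ) : ℂ) = ((1 - y : ℝ) : ℂ) := by push_cast; field_simp
  have e2 : 1 - ((x / y : ℝ) : ℂ) / (x : ℂ) = ((1 - y⁻¹ : ℝ) : ℂ) := by push_cast; field_simp
  rw [e1, e2, appellF3_eq_pfaffSeries _ _ _ _ hγ, pfaffSeries]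
  · have e3 : (1 : ℂ) - ((1 - y⁻¹ : ℝ) : ℂ) = (y : ℂ)⁻¹ := by push_cast; ring
    have e4 : ((1 - y⁻¹ : ℝ) : ℂ) / (((1 - y⁻¹ : ℝ) : ℂ) - 1) = 1 - (y : ℂ) := by
      push_cast; field_simp; ring
    have e5 : ((1 - y : ℝ) : ℂ) = 1 - (y : ℂ) := by push_cast; ring
    rw [e3, e4, e5, kernelSeries, Complex.cpow_neg, Complex.inv_cpow, inv_inv]
    · simp only [pow_add, mul_assoc]
    · rw [Complex.arg_ofReal_of_nonneg hy.1.le]; exact Real.pi_pos.ne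
  · rw [Complex.norm_real, Real.norm_eq_abs, abs_lt]
    constructor <;> linarith [hy.1, hy.2]
  · rw [Complex.ofReal_re]
    linarith [(one_lt_inv₀ hy.1).mpr hy.2]

lemma image_div_Ioo {x : ℝ} (hx : 0 < x) : (fun y : ℝ => x / y) '' Ioo 0 1 = Ioi x := by
  ext t
  constructor
  · rintro ⟨y, hy, rfl⟩
    exact (lt_div_iff₀ hy.1).mpr (by nlinarith [hy.2])
  · intro ht
    have ht : x < t := ht
    have ht0 : 0 < t := hx.trans ht
    exact ⟨x / t, ⟨by positivity, (div_lt_one ht0).mpr ht⟩, by field_simp⟩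

/-- The substitution `t = x / y` in the integral operator applied to `t ^ ρ g(t)`. -/
lemma abs_deriv_smul_msmRightIntegrand (α α' β β' : ℂ) {γ : ℂ} (hγ : 0 < γ.re) (ρ : ℂ)
    (g : ℝ → ℂ) {x y : ℝ} (hx : 0 < x) (hy : y ∈ Ioo (0 : ℝ) 1) :
    |-x / y ^ 2| • msmRightIntegrand α α' β β' γ (fun t : ℝ => (t : ℂ) ^ ρ * g t) x (x / y) =
      (x : ℂ) ^ (γ - α + ρ) *
        ((y : ℂ) ^ (-ρ - 1) * msmKernel α α' β β' γ y * g (x / y)) := by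
  have hx0 : (x : ℂ) ≠ 0 := by exact_mod_cast hx.ne'
  have hy0 : (y : ℂ) ≠ 0 := by exact_mod_cast hy.1.ne'
  have hy1 : 0 ≤ 1 - y := by linarith [hy.2]
  have hyarg : (y : ℂ).arg ≠ Real.pi := by
    rw [Complex.arg_ofReal_of_nonneg hy.1.le]; exact Real.pi_pos.ne
  have hdiv : ∀ s : ℂ, ((x / y : ℝ) : ℂ) ^ s = (x : ℂ) ^ s * (y : ℂ) ^ (-s) := by
    intro s
    rw [div_eq_mul_inv, Complex.ofReal_mul, Complex.mul_cpow_ofReal_nonneg hx.le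
      (inv_nonneg.mpr hy.1.le), Complex.ofReal_inv, Complex.inv_cpow _ _ hyarg, Complex.cpow_neg]
  have hsub : ((x / y - x : ℝ) : ℂ) ^ (γ - 1) =
      (x : ℂ) ^ (γ - 1) * (y : ℂ) ^ (-(γ - 1)) * (1 - (y : ℂ)) ^ (γ - 1) := by
    have hy0' : y ≠ 0 := hy.1.ne'
    have e : x / y - x = x / y * (1 - y) := by field_simp
    rw [e, Complex.ofReal_mul, Complex.mul_cpow_ofReal_nonneg (div_nonneg hx.le hy.1.le) hy1, hdiv]
    push_cast; ring
  have habs : |-x / y ^ 2| = x / y ^ 2 := by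
    rw [abs_div, abs_neg, abs_of_pos hx, abs_of_nonneg (sq_nonneg y)]
  rw [habs, Complex.real_smul, msmRightIntegrand, hsub, hdiv, hdiv,
    appellF3_div_eq _ _ _ _ hγ hx hy, msmKernel_apply]
  have px : (x : ℂ) ^ (γ - α + ρ) = x * (x : ℂ) ^ (γ - 1) * (x : ℂ) ^ (-α) * (x : ℂ) ^ ρ := by
    conv_rhs => enter [1, 1, 1]; rw [← Complex.cpow_one (x : ℂ)]
    rw [← Complex.cpow_add _ _ hx0, ← Complex.cpow_add _ _ hx0, ← Complex.cpow_add _ _ hx0]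
    congr 1; ring
  have py : (y : ℂ) ^ (-ρ - 1) * (y : ℂ) ^ (α + α' - γ) = ((y : ℂ) ^ 2)⁻¹ * (y : ℂ) ^ (-(γ - 1)) *
      (y : ℂ) ^ (-(-α)) * (y : ℂ) ^ α' * (y : ℂ) ^ (-ρ) := by
    have e : ((y : ℂ) ^ 2)⁻¹ = (y : ℂ) ^ (-2 : ℂ) := by
      rw [Complex.cpow_neg]; norm_cast
    rw [e, ← Complex.cpow_add _ _ hy0, ← Complex.cpow_add _ _ hy0, ← Complex.cpow_add _ _ hy0,
      ← Complex.cpow_add _ _ hy0, ← Complex.cpow_add _ _ hy0]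
    congr 1; ring
  have py' : (y : ℂ) ^ (-ρ - 1) * ((y : ℂ) ^ (α + α' - γ) * ((1 - (y : ℂ)) ^ (γ - 1) *
      kernelSeries α α' β β' γ (1 - y))) = ((y : ℂ) ^ (-ρ - 1) * (y : ℂ) ^ (α + α' - γ)) *
      ((1 - (y : ℂ)) ^ (γ - 1) * kernelSeries α α' β β' γ (1 - y)) := by ring
  rw [px, py', py]
  push_cast
  rw [div_eq_mul_inv]
  ring

lemma msmRight_substitution (α α' β β' : ℂ) {γ : ℂ} (hγ : 0 < γ.re) (ρ : ℂ)
    (g : ℝ → ℂ) {x : ℝ} (hx : 0 < x)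
    (hg : IntegrableOn (fun y : ℝ => (y : ℂ) ^ (-ρ - 1) * msmKernel α α' β β' γ y * g (x / y))
      (Ioo 0 1)) :
    IntegrableOn (msmRightIntegrand α α' β β' γ (fun t : ℝ => (t : ℂ) ^ ρ * g t) x) (Ioi x) ∧
    msmRight α α' β β' γ (fun t : ℝ => (t : ℂ) ^ ρ * g t) x =
      (x : ℂ) ^ (ρ - α - α' + γ) * ((Complex.Gamma γ)⁻¹ * ∫ y in Ioo (0 : ℝ) 1,
        (y : ℂ) ^ (-ρ - 1) * msmKernel α α' β β' γ y * g (x / y)) := by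
  have hx0 : (x : ℂ) ≠ 0 := by exact_mod_cast hx.ne'
  have hderiv : ∀ y ∈ Ioo (0 : ℝ) 1,
      HasDerivWithinAt (fun y : ℝ => x / y) (-x / y ^ 2) (Ioo 0 1) y := by
    intro y hy
    have h := (hasDerivAt_inv hy.1.ne').const_mul x
    have h2 : HasDerivAt (fun y : ℝ => x / y) (-x / y ^ 2) y := by
      have e : -x / y ^ 2 = x * -(y ^ 2)⁻¹ := by rw [neg_div, div_eq_mul_inv]; ring
      rw [e]
      exact h.congr_of_eventuallyEq (Filter.Eventually.of_forall fun _ => div_eq_mul_inv _ _)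
    exact h2.hasDerivWithinAt
  have hinj : InjOn (fun y : ℝ => x / y) (Ioo 0 1) := by
    intro y hy y' hy' h
    have h1 := hy.1.ne'
    have h2 := hy'.1.ne'
    simp only at h
    field_simp at h
    exact h.symm
  have hEq : EqOn (fun y : ℝ => |-x / y ^ 2| •
      msmRightIntegrand α α' β β' γ (fun t : ℝ => (t : ℂ) ^ ρ * g t) x (x / y))
      (fun y : ℝ => (x : ℂ) ^ (γ - α + ρ) *
        ((y : ℂ) ^ (-ρ - 1) * msmKernel α α' β β' γ y * g (x / y))) (Ioo 0 1) :=
    fun y hy => abs_deriv_smul_msmRightIntegrand α α' β β' hγ ρ g hx hy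
  constructor
  · rw [← image_div_Ioo hx, integrableOn_image_iff_integrableOn_abs_deriv_smul measurableSet_Ioo
      hderiv hinj]
    exact IntegrableOn.congr_fun (hg.const_mul _) hEq.symm measurableSet_Ioo
  · rw [msmRight, ← image_div_Ioo hx, integral_image_eq_integral_abs_deriv_smul measurableSet_Ioo
      hderiv hinj, setIntegral_congr_fun measurableSet_Ioo hEq, integral_const_mul]
    have e : (x : ℂ) ^ (ρ - α - α' + γ) = (x : ℂ) ^ (-α') * (x : ℂ) ^ (γ - α + ρ) := by
      rw [← Complex.cpow_add _ _ hx0]; congr 1; ring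
    rw [e, div_eq_mul_inv]; ring

/-! ### Summation over the hyperbolic cosine series -/

lemma poch_two_mul (a : ℂ) (k : ℕ) :
    poch a (2 * k) = 4 ^ k * (poch (a / 2) k * poch ((a + 1) / 2) k) := by
  induction k with
  | zero => simp
  | succ k ih =>
    rw [show 2 * (k + 1) = 2 * k + 1 + 1 by ring, poch_succ, poch_succ, ih, poch_succ, poch_succ]
    push_cast; ring

lemma poch_one (n : ℕ) : poch 1 n = n.factorial := by
  simp [poch, ascPochhammer_eval_one]

lemma factorial_two_mul (k : ℕ) :
    ((2 * k).factorial : ℂ) = 4 ^ k * (poch (1 / 2) k * k.factorial) := by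
  rw [← poch_one, poch_two_mul, ← poch_one k]; norm_num

/-- Replacing `ρ` by `ρ - 2 k` multiplies the Gamma ratio by Pochhammer symbols, which the
duplication formula splits into the parameters of the `₆F₇`. -/
lemma msmGammaRatio_sub_two_mul {α α' β β' γ ρ : ℂ}
    (h₁ : ∀ k : ℕ, -ρ ≠ -(k : ℂ)) (h₂ : ∀ k : ℕ, α + α' + β' - γ - ρ ≠ -(k : ℂ))
    (h₃ : ∀ k : ℕ, α - β - ρ ≠ -(k : ℂ)) (g₁ : 0 < (α + α' - γ - ρ).re)
    (g₂ : 0 < (α + β' - γ - ρ).re) (g₃ : 0 < (-β - ρ).re) (w : ℂ) (k : ℕ) :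
    w ^ (2 * k) / (2 * k).factorial * msmGammaRatio α α' β β' γ (ρ - (2 * k : ℕ)) =
      msmGammaRatio α α' β β' γ ρ *
        ((([(α + α' - γ - ρ) / 2, (α + α' - γ - ρ + 1) / 2, (α + β' - γ - ρ) / 2,
          (α + β' - γ - ρ + 1) / 2, (-β - ρ) / 2, (-β - ρ + 1) / 2] : List ℂ).map
            fun a => poch a k).prod /
          ((([1 / 2, -ρ / 2, (-ρ + 1) / 2, (α + α' + β' - γ - ρ) / 2,
            (α + α' + β' - γ - ρ + 1) / 2, (α - β - ρ) / 2, (α - β - ρ + 1) / 2] : List ℂ).map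
            fun b => poch b k).prod * (k.factorial : ℂ)) * (w ^ 2 / 4) ^ k) := by
  have e : ∀ u : ℂ, u - (ρ - ((2 * k : ℕ) : ℂ)) = u - ρ + (2 * k : ℕ) := fun u => by ring
  rw [msmGammaRatio, e, e, e, e, e, show -(ρ - ((2 * k : ℕ) : ℂ)) = -ρ + (2 * k : ℕ) by ring,
    Gamma_add_natCast (ne_neg_natCast_of_re_pos g₁),
    Gamma_add_natCast (ne_neg_natCast_of_re_pos g₂),
    Gamma_add_natCast (ne_neg_natCast_of_re_pos g₃), Gamma_add_natCast h₁, Gamma_add_natCast h₂,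
    Gamma_add_natCast h₃, msmGammaRatio, factorial_two_mul]
  simp only [poch_two_mul, List.map_cons, List.map_nil, List.prod_cons, List.prod_nil, mul_one]
  rw [div_pow, ← pow_mul]
  have cancel : ∀ W F q G₁ G₂ G₃ G₄ G₅ G₆ P₁ P₂ P₃ P₄ P₅ P₆ Q₀ Q₁ Q₂ Q₃ Q₄ Q₅ Q₆ : ℂ, q ≠ 0 →
      W / (q * (Q₀ * F)) * (q * (P₁ * P₂) * G₁ * (q * (P₃ * P₄) * G₂) * (q * (P₅ * P₆) * G₃) /
        (q * (Q₁ * Q₂) * G₄ * (q * (Q₃ * Q₄) * G₅) * (q * (Q₅ * Q₆) * G₆))) =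
      G₁ * G₂ * G₃ / (G₄ * G₅ * G₆) * (P₁ * (P₂ * (P₃ * (P₄ * (P₅ * P₆)))) /
        (Q₀ * (Q₁ * (Q₂ * (Q₃ * (Q₄ * (Q₅ * Q₆))))) * F) * (W / q)) := by
    intro W F q G₁ G₂ G₃ G₄ G₅ G₆ P₁ P₂ P₃ P₄ P₅ P₆ Q₀ Q₁ Q₂ Q₃ Q₄ Q₅ Q₆ hq
    have e : q * q * q * q⁻¹ * q⁻¹ * q⁻¹ * q⁻¹ = q⁻¹ := by field_simp
    simp only [div_eq_mul_inv, mul_inv]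
    linear_combination (W * Q₀⁻¹ * F⁻¹ * P₁ * P₂ * P₃ * P₄ * P₅ * P₆ * G₁ * G₂ * G₃ *
      Q₁⁻¹ * Q₂⁻¹ * Q₃⁻¹ * Q₄⁻¹ * Q₅⁻¹ * Q₆⁻¹ * G₄⁻¹ * G₅⁻¹ * G₆⁻¹) * e
  exact cancel _ _ _ _ _ _ _ _ _ _ _ _ _ _ _ _ _ _ _ _ _ _ (pow_ne_zero k (by norm_num))

/-- The integral against `cosh (w y)` is the sum over `k` of the Mellin transforms at `-ρ + 2 k`. -/
lemma integral_mul_cosh {α α' β β' γ ρ : ℂ} (hγ : 0 < γ.re) (g₁ : 0 < (α + α' - γ - ρ).re)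
    (g₂ : 0 < (α + β' - γ - ρ).re) (g₃ : 0 < (-β - ρ).re) (w : ℂ) :
    IntegrableOn (fun y : ℝ => (y : ℂ) ^ (-ρ - 1) * msmKernel α α' β β' γ y *
      Complex.cosh (w * y)) (Ioo 0 1) ∧
    HasSum (fun k : ℕ => Complex.Gamma γ *
      (w ^ (2 * k) / (2 * k).factorial * msmGammaRatio α α' β β' γ (ρ - (2 * k : ℕ))))
      (∫ y in Ioo (0 : ℝ) 1, (y : ℂ) ^ (-ρ - 1) * msmKernel α α' β β' γ y *
        Complex.cosh (w * y)) := by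
  have hcc : (0 : ℂ) + (α + α' + β' - γ) + (α - β) - (α + α' - γ) - (α + β' - γ) - (-β) = γ := by
    ring
  have hk : ∀ k : ℕ,
      IntegrableOn (fun y : ℝ => (y : ℂ) ^ (-ρ + (2 * k : ℕ) - 1) * msmKernel α α' β β' γ y)
        (Ioo 0 1) ∧
      ∫ y in Ioo (0 : ℝ) 1, (y : ℂ) ^ (-ρ + (2 * k : ℕ) - 1) * msmKernel α α' β β' γ y =
        Complex.Gamma γ * msmGammaRatio α α' β β' γ (ρ - (2 * k : ℕ)) := by
    intro k
    have hk0 : (0 : ℝ) ≤ ((2 * k : ℕ) : ℝ) := Nat.cast_nonneg _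
    have pos : ∀ u : ℂ, 0 < (u - ρ).re → 0 < (-ρ + (2 * k : ℕ) + u).re := by
      intro u hu
      simp only [Complex.sub_re, Complex.add_re, Complex.neg_re, Complex.natCast_re] at hu ⊢
      linarith
    have key := mellin_mellinKernel (z := -ρ + (2 * k : ℕ)) (by rw [hcc]; exact hγ)
      (pos _ g₁) (pos _ g₂) (pos _ g₃)
    refine ⟨key.1, ?_⟩
    rw [hcc] at key
    refine key.2.trans ?_
    rw [msmGammaRatio]
    congr 3
    all_goals ring_nf
  set h : ℝ → ℂ := fun y => (y : ℂ) ^ (-ρ - 1) * msmKernel α α' β β' γ y with hh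
  have hint : IntegrableOn h (Ioo 0 1) := by simpa using (hk 0).1
  set F : ℕ → ℝ → ℂ := fun k y => w ^ (2 * k) / (2 * k).factorial *
    ((y : ℂ) ^ (-ρ + (2 * k : ℕ) - 1) * msmKernel α α' β β' γ y) with hF
  have hFint : ∀ k, Integrable (F k) (volume.restrict (Ioo 0 1)) := fun k => (hk k).1.const_mul _
  have hFh : ∀ k, ∀ y ∈ Ioo (0 : ℝ) 1,
      F k y = h y * ((w * y) ^ (2 * k) / (2 * k).factorial) := by
    intro k y hy
    have hy0 : (y : ℂ) ≠ 0 := by exact_mod_cast hy.1.ne'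
    simp only [hF, hh]
    rw [add_sub_right_comm, Complex.cpow_add _ _ hy0, Complex.cpow_natCast, mul_pow]
    ring
  have hFsum : Summable fun k => ∫ y in Ioo (0 : ℝ) 1, ‖F k y‖ := by
    refine Summable.of_nonneg_of_le (fun k => integral_nonneg fun _ => norm_nonneg _) (fun k => ?_)
      ((Real.hasSum_cosh ‖w‖).summable.mul_right (∫ y in Ioo (0 : ℝ) 1, ‖h y‖))
    rw [← integral_const_mul]
    refine setIntegral_mono_on (hFint k).norm (hint.norm.const_mul _) measurableSet_Ioo
      fun y hy => ?_
    rw [hFh k y hy, norm_mul (h y), norm_div, norm_pow, norm_mul w, Complex.norm_natCast,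
      Complex.norm_of_nonneg hy.1.le, mul_comm]
    have hwy : 0 ≤ ‖w‖ * y := mul_nonneg (norm_nonneg w) hy.1.le
    gcongr
    exact mul_le_of_le_one_right (norm_nonneg w) hy.2.le
  have hEq : EqOn (fun y => ∑' k, F k y) (fun y : ℝ => h y * Complex.cosh (w * y)) (Ioo 0 1) := by
    intro y hy
    simp only [hFh _ y hy]
    rw [tsum_mul_left, ← Complex.cosh_eq_tsum]
  have hsum := hasSum_integral_of_summable_integral_norm hFint hFsum
  rw [setIntegral_congr_fun measurableSet_Ioo hEq] at hsum
  refine ⟨IntegrableOn.congr_fun (integrable_tsum_of_summable_integral_norm hFint hFsum) hEq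
    measurableSet_Ioo, ?_⟩
  refine hsum.congr_fun fun k => ?_
  simp only [hF]
  rw [integral_const_mul, (hk k).2]; ring

/-- The image of `t ^ ρ cosh (c / t)`. -/
theorem msmRight_cosh {α α' β β' γ ρ : ℂ} (c : ℂ) {x : ℝ} (hx : 0 < x) (hγ : 0 < γ.re)
    (hρ : ρ.re < min (-β).re (min (α + α' - γ).re (α + β' - γ).re))
    (h₁ : ∀ k : ℕ, -ρ ≠ -(k : ℂ))
    (h₂ : ∀ k : ℕ, α + α' + β' - γ - ρ ≠ -(k : ℂ))
    (h₃ : ∀ k : ℕ, α - β - ρ ≠ -(k : ℂ)) :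
    IntegrableOn (msmRightIntegrand α α' β β' γ
        (fun t : ℝ => (t : ℂ) ^ ρ * Complex.cosh (c / (t : ℂ))) x) (Ioi x) ∧
      msmRight α α' β β' γ (fun t : ℝ => (t : ℂ) ^ ρ * Complex.cosh (c / (t : ℂ))) x =
        msmGammaRatio α α' β β' γ ρ * (x : ℂ) ^ (ρ - α - α' + γ) *
          msmSixFSeven α α' β β' γ ρ (c ^ 2 / (4 * (x : ℂ) ^ 2)) := by
  have hx0 : (x : ℂ) ≠ 0 := by exact_mod_cast hx.ne'
  obtain ⟨g₃, g₁, g₂⟩ : 0 < (-β - ρ).re ∧ 0 < (α + α' - γ - ρ).re ∧ 0 < (α + β' - γ - ρ).re := by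
    rw [lt_min_iff, lt_min_iff] at hρ
    rw [Complex.sub_re (-β), Complex.sub_re (α + α' - γ), Complex.sub_re (α + β' - γ)]
    exact ⟨by linarith [hρ.1], by linarith [hρ.2.1], by linarith [hρ.2.2]⟩
  have key := integral_mul_cosh hγ g₁ g₂ g₃ (c / x)
  have e : ∀ y : ℝ, Complex.cosh (c / ((x / y : ℝ) : ℂ)) = Complex.cosh (c / x * y) := by
    intro y
    congr 1
    push_cast
    rw [div_div_eq_mul_div]; ring
  have hsub := msmRight_substitution α α' β β' hγ ρ (fun t => Complex.cosh (c / (t : ℂ))) hx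
    (by simp only [e]; exact key.1)
  refine ⟨hsub.1, hsub.2.trans ?_⟩
  simp only [e]
  have hG := Complex.Gamma_ne_zero_of_re_pos hγ
  rw [← key.2.tsum_eq, tsum_mul_left, inv_mul_cancel_left₀ hG]
  simp only [msmGammaRatio_sub_two_mul h₁ h₂ h₃ g₁ g₂ g₃]
  have hz : (c / (x : ℂ)) ^ 2 / 4 = c ^ 2 / (4 * (x : ℂ) ^ 2) := by field_simp
  rw [tsum_mul_left, hz, msmSixFSeven, genHypergeom]
  ring

theorem mainTheorem8 (α α' β β' γ ρ c : ℂ) (x : ℝ) (hx : 0 < x) (hγ : 0 < γ.re)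
    (hρ : ρ.re < min (-β).re (min (α + α' - γ).re (α + β' - γ).re))
    (h₁ : ∀ k : ℕ, -ρ ≠ -(k : ℂ))
    (h₂ : ∀ k : ℕ, α + α' + β' - γ - ρ ≠ -(k : ℂ))
    (h₃ : ∀ k : ℕ, α - β - ρ ≠ -(k : ℂ)) :
    (IntegrableOn (msmRightIntegrand α α' β β' γ
        (fun t : ℝ => (t : ℂ) ^ ρ * Complex.cos (c / (t : ℂ))) x) (Ioi x) ∧
      msmRight α α' β β' γ (fun t : ℝ => (t : ℂ) ^ ρ * Complex.cos (c / (t : ℂ))) x =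
        msmGammaRatio α α' β β' γ ρ * (x : ℂ) ^ (ρ - α - α' + γ) *
          msmSixFSeven α α' β β' γ ρ (-(c ^ 2 / (4 * (x : ℂ) ^ 2)))) ∧
    (IntegrableOn (msmRightIntegrand α α' β β' γ
        (fun t : ℝ => (t : ℂ) ^ ρ * Complex.cosh (c / (t : ℂ))) x) (Ioi x) ∧
      msmRight α α' β β' γ (fun t : ℝ => (t : ℂ) ^ ρ * Complex.cosh (c / (t : ℂ))) x =
        msmGammaRatio α α' β β' γ ρ * (x : ℂ) ^ (ρ - α - α' + γ) *
          msmSixFSeven α α' β β' γ ρ (c ^ 2 / (4 * (x : ℂ) ^ 2))) := by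
  refine ⟨?_, msmRight_cosh c hx hγ hρ h₁ h₂ h₃⟩
  have key := msmRight_cosh (c * Complex.I) hx hγ hρ h₁ h₂ h₃
  have e : ∀ t : ℝ, Complex.cosh (c * Complex.I / (t : ℂ)) = Complex.cos (c / (t : ℂ)) := by
    intro t
    rw [← Complex.cosh_mul_I, div_mul_eq_mul_div]
  have e2 : (c * Complex.I) ^ 2 / (4 * (x : ℂ) ^ 2) = -(c ^ 2 / (4 * (x : ℂ) ^ 2)) := by
    rw [mul_pow, Complex.I_sq]; ring
  simpa only [e, e2] using key
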